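/- A language $L \subseteq \{0,1\}^\star$ is in the complexity class PP if and only if there exist a polynomial $p$ and a polynomial-time predicate $M$ (that is, a map $M : \{0,1\}^\star \times \{0,1\}^\star \to \{0,1\}$ computed by a polynomial-time Turing machine whose output is either 0 or 1) such that: for all $x \in L$, the fraction of strings $y$ of length $p(|x|)$ which satisfy $M(x,y) = 1$ is strictly greater than $1/2$; and for all $x \notin L$, the fraction of strings $y$ of length $p(|x|)$ which satisfy $M(x,y) = 1$ is less than or equal to $1/2$. Theorem. The intersection of finitely many languages in PP is itself in PP. -/

import Mathlib

/-- The encoding of a pair `(x, y)` of bit strings on an input tape: the symbols of `x`, followed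
by the symbols of `y`, over two disjoint copies of `{0,1}` (so that the machine sees where `x` ends
and `y` begins). The length of the encoding is `|x| + |y|`. -/
def bitPairEncoding : Computability.Encoding (List Bool × List Bool) (Bool ⊕ Bool) :=
  Computability.encodingProd (Computability.encodingList Bool) (Computability.encodingList Bool)

/-- A polynomial-time predicate: a map `M : {0,1}* × {0,1}* → {0,1}` which some Turing machine
computes, with output the single bit `M (x, y)`, in a number of steps bounded by a polynomial
in `|x| + |y|`. -/
def IsPolyTimePredicate (M : List Bool × List Bool → Bool) : Prop :=
  Nonempty (Turing.TM2ComputableInPolyTime bitPairEncoding.encode Computability.encodeBool M)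

/-- The fraction of the strings `y ∈ {0,1}ⁿ` which satisfy `M (x, y) = 1`. -/
def acceptFraction (M : List Bool × List Bool → Bool) (x : List Bool) (n : ℕ) : ℚ :=
  (Fintype.card {y : List.Vector Bool n // M (x, y.toList) = true} : ℚ) /
    (Fintype.card (List.Vector Bool n) : ℚ)

/-- The complexity class PP: the languages `L ⊆ {0,1}*` for which there are a polynomial `p` and a
polynomial-time predicate `M` such that the fraction of the strings `y` of length `p(|x|)` with
`M (x, y) = 1` is greater than `1/2` for all `x ∈ L`, and at most `1/2` for all `x ∉ L`. -/
def PP : Set (Language Bool) :=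
  {L | ∃ (p : Polynomial ℕ) (M : List Bool × List Bool → Bool), IsPolyTimePredicate M ∧
    (∀ x ∈ L, 1 / 2 < acceptFraction M x (p.eval x.length)) ∧
    (∀ x ∉ L, acceptFraction M x (p.eval x.length) ≤ 1 / 2)}

/-! For an input `x`, let `z` be the gap of the first predicate: accepting minus rejecting strings.
Membership means `0 < z`, and always `z ≤ 2^p` (`mem_PP_iff`, `bitSum_bitSign_le`). The sign of `z`
is not visible to a counting machine, but low-degree polynomials in `z` are gaps again, because gaps
add and multiply over independent choices. As in the Beigel–Reingold–Spielman argument, put `A = ∏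
(z + 2^k)²` and `B = ∏ (z - 2^k)²` over `k ≤ p`. If `z ≤ 0` then `A ≤ B`. If `0 < z ≤ 2^p`, the
factor with `2^k ≤ z < 2^(k+1)` alone forces `9B ≤ A`. With `C`, `D` formed likewise from the gap
`w` of the second predicate, `AC - AD - BC - BD = 2AC - (A + B)(C + D)` is positive exactly when `z`
and `w` both are (`pos_and_pos_iff`).

It remains to realize this integer, up to a factor 2, as the gap of one polynomial-time predicate. A
block of `p + 1` bits has gap `z ± 2^k`: its first bit chooses between running the predicate and
testing that `p - k` prescribed bits vanish, a test passed by `2^k` strings. Consecutive blocks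
multiply, two passes give squares, and one selector bit per language chooses between `A` and `B`, or
between `C` and `D` (`bitSum_combinedPred`). Blocks may have value 0, so a last bit breaks ties.

Polynomial time is proved with an explicit stack program that calls the two given machines as
subroutines (`exists_frag_combinedPred`, `computes_callFrag`). Finite intersections follow by
induction from `inf_mem_PP` and `top_mem_PP`. -/

open Turing Turing.TM2

/-! ### Composition of stack programs with time bounds. -/

section Framework

variable {K : Type} [DecidableEq K] {Γ : K → Type} {σ : Type}

/-- `StepsTo m c c' n`: the program `m` leads from the configuration `c` to `c'` in `n` steps. -/
inductive StepsTo {Λ : Type} (m : Λ → Stmt Γ Λ σ) : Cfg Γ Λ σ → Cfg Γ Λ σ → ℕ → Prop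
  | refl (c) : StepsTo m c c 0
  | head {c c' c'' n} : step m c = some c' → StepsTo m c' c'' n → StepsTo m c c'' (n + 1)

theorem StepsTo.trans {Λ : Type} {m : Λ → Stmt Γ Λ σ} {c c' c'' : Cfg Γ Λ σ} {n n' : ℕ}
    (h : StepsTo m c c' n) (h' : StepsTo m c' c'' n') : StepsTo m c c'' (n + n') := by
  induction h with
  | refl => simpa using h'
  | @head _ _ _ k hs _ ih => rw [Nat.add_right_comm]; exact .head hs (ih h')

theorem StepsTo.iterate_bind {Λ : Type} {m : Λ → Stmt Γ Λ σ} {c c' : Cfg Γ Λ σ} {n : ℕ}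
    (h : StepsTo m c c' n) : (flip bind (step m))^[n] (some c) = some c' := by
  induction h with
  | refl => rfl
  | @head c _ _ _ hs _ ih =>
    rw [Function.iterate_succ_apply]
    change (flip bind (step m))^[_] (step m c) = _
    rw [hs]
    exact ih

theorem StepsTo.of_iterate_bind {Λ : Type} {m : Λ → Stmt Γ Λ σ} {c' : Cfg Γ Λ σ} {n : ℕ} :
    ∀ {c : Cfg Γ Λ σ}, (flip bind (step m))^[n] (some c) = some c' → StepsTo m c c' n := by
  induction n with
  | zero => intro c h; cases h; exact .refl _
  | succ n ih =>
    intro c h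
    rw [Function.iterate_succ_apply] at h
    change (flip bind (step m))^[n] (step m c) = _ at h
    cases hc : step m c with
    | none =>
      have hnone : ∀ k, (flip bind (step m))^[k] none = none := fun k => by
        induction k with
        | zero => rfl
        | succ k ih => rw [Function.iterate_succ_apply]; exact ih
      rw [hc, hnone] at h
      cases h
    | some d => rw [hc] at h; exact .head hc (ih h)

/-- Rename the labels of a statement, and continue at `e` instead of halting. -/
def relabel {Λ Λ' : Type} (f : Λ → Λ') (e : Option Λ') : Stmt Γ Λ σ → Stmt Γ Λ' σ
  | .push k g q => .push k g (relabel f e q)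
  | .peek k g q => .peek k g (relabel f e q)
  | .pop k g q => .pop k g (relabel f e q)
  | .load g q => .load g (relabel f e q)
  | .branch g q₁ q₂ => .branch g (relabel f e q₁) (relabel f e q₂)
  | .goto g => .goto fun s => f (g s)
  | .halt => e.elim .halt fun l => .goto fun _ => l

/-- The configuration that corresponds to `c` after `relabel f e`. -/
def relabelCfg {Λ Λ' : Type} (f : Λ → Λ') (e : Option Λ') (c : Cfg Γ Λ σ) : Cfg Γ Λ' σ :=
  ⟨c.l.elim e fun l => some (f l), c.var, c.stk⟩

theorem stepAux_relabel {Λ Λ' : Type} (f : Λ → Λ') (e : Option Λ') (q : Stmt Γ Λ σ) :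
    ∀ v S, stepAux (relabel f e q) v S = relabelCfg f e (stepAux q v S) := by
  induction q with
  | branch g q₁ q₂ ih₁ ih₂ => intro v S; simp only [relabel, stepAux]; cases g v <;> simp [ih₁, ih₂]
  | goto => intro v S; rfl
  | halt => intro v S; cases e <;> rfl
  | push _ _ _ ih => intro v S; simp [relabel, ih]
  | peek _ _ _ ih => intro v S; simp [relabel, ih]
  | pop _ _ _ ih => intro v S; simp [relabel, ih]
  | load _ _ ih => intro v S; simp [relabel, ih]

theorem StepsTo.relabel {Λ Λ' : Type} {f : Λ → Λ'} {e : Option Λ'} {m : Λ → Stmt Γ Λ σ}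
    {m' : Λ' → Stmt Γ Λ' σ} (hm : ∀ l, m' (f l) = relabel f e (m l)) {c c' : Cfg Γ Λ σ} {n : ℕ}
    (h : StepsTo m c c' n) : StepsTo m' (relabelCfg f e c) (relabelCfg f e c') n := by
  induction h with
  | refl => exact .refl _
  | @head c _ _ _ hs _ ih =>
    refine .head ?_ ih
    obtain ⟨_ | l, v, S⟩ := c
    · simp at hs
    · simp only [step, Option.some.injEq] at hs
      subst hs
      simp [relabelCfg, hm, stepAux_relabel]

/-- A program over the stacks `Γ` and the internal states `σ`, to be left by halting. -/
structure Frag (Γ : K → Type) (σ : Type) where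
  Λ : Type
  fin : Fintype Λ
  entry : Λ
  code : Λ → Stmt Γ Λ σ

/-- The contents of a machine's memory. -/
abbrev Mem (Γ : K → Type) (σ : Type) := σ × (∀ k, List (Γ k))

/-- `F.Exec a a' t`: started with memory `a`, the program `F` halts within `t` steps
with memory `a'`. -/
def Frag.Exec (F : Frag Γ σ) (a a' : Mem Γ σ) (t : ℕ) : Prop :=
  ∃ n ≤ t, StepsTo F.code ⟨some F.entry, a.1, a.2⟩ ⟨none, a'.1, a'.2⟩ n

theorem Frag.Exec.mono {F : Frag Γ σ} {a a' : Mem Γ σ} {t t' : ℕ} (h : F.Exec a a' t)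
    (ht : t ≤ t') : F.Exec a a' t' :=
  h.imp fun _ hn => ⟨hn.1.trans ht, hn.2⟩

/-- The program that repeats the statement `q` until it halts. -/
def Frag.rep (q : Stmt Γ Unit σ) : Frag Γ σ := ⟨Unit, inferInstance, (), fun _ => q⟩

theorem Frag.rep_halt {q : Stmt Γ Unit σ} {a a' : Mem Γ σ}
    (h : stepAux q a.1 a.2 = ⟨none, a'.1, a'.2⟩) : (Frag.rep q).Exec a a' 1 :=
  ⟨1, le_rfl, .head (congrArg some h) (.refl _)⟩

theorem Frag.rep_again {q : Stmt Γ Unit σ} {a a₁ a' : Mem Γ σ} {t : ℕ}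
    (h : stepAux q a.1 a.2 = ⟨some (), a₁.1, a₁.2⟩) (h' : (Frag.rep q).Exec a₁ a' t) :
    (Frag.rep q).Exec a a' (t + 1) := by
  obtain ⟨n, hn, hs⟩ := h'
  exact ⟨n + 1, by omega, .head (congrArg some h) hs⟩

/-- The program that runs `F` and then `G`. -/
def Frag.seq (F G : Frag Γ σ) : Frag Γ σ :=
  letI := F.fin
  letI := G.fin
  ⟨F.Λ ⊕ G.Λ, inferInstance, .inl F.entry,
    Sum.elim (fun l => relabel .inl (some (.inr G.entry)) (F.code l))
      fun l => relabel .inr none (G.code l)⟩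

theorem Frag.Exec.seq {F G : Frag Γ σ} {a a₁ a' : Mem Γ σ} {t t' : ℕ} (h : F.Exec a a₁ t)
    (h' : G.Exec a₁ a' t') : (F.seq G).Exec a a' (t + t') := by
  obtain ⟨n, hn, hs⟩ := h
  obtain ⟨n', hn', hs'⟩ := h'
  refine ⟨n + n', by omega, ?_⟩
  exact StepsTo.trans
    (hs.relabel (f := Sum.inl) (e := some (.inr G.entry)) (m' := (F.seq G).code) fun _ => rfl)
    (hs'.relabel (f := Sum.inr) (e := none) (m' := (F.seq G).code) fun _ => rfl)

/-- The program that executes the statement `q`, stops if `q` halts, and otherwise runs `F`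
and starts again. -/
def Frag.loop (q : Stmt Γ Unit σ) (F : Frag Γ σ) : Frag Γ σ :=
  letI := F.fin
  ⟨Option F.Λ, inferInstance, none,
    fun l => l.elim (relabel (fun _ => some F.entry) none q)
      fun l => relabel some (some none) (F.code l)⟩

theorem Frag.loop_halt {q : Stmt Γ Unit σ} {F : Frag Γ σ} {a a' : Mem Γ σ}
    (h : stepAux q a.1 a.2 = ⟨none, a'.1, a'.2⟩) : (Frag.loop q F).Exec a a' 1 := by
  refine ⟨1, le_rfl, .head ?_ (.refl _)⟩
  simp [Frag.loop, stepAux_relabel, h, relabelCfg]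

theorem Frag.loop_again {q : Stmt Γ Unit σ} {F : Frag Γ σ} {a a₁ a₂ a' : Mem Γ σ} {t t' : ℕ}
    (h : stepAux q a.1 a.2 = ⟨some (), a₁.1, a₁.2⟩) (hF : F.Exec a₁ a₂ t)
    (h' : (Frag.loop q F).Exec a₂ a' t') : (Frag.loop q F).Exec a a' (t + t' + 1) := by
  obtain ⟨n, hn, hs⟩ := hF
  obtain ⟨n', hn', hs'⟩ := h'
  refine ⟨n + n' + 1, by omega, .head (c' := ⟨some (some F.entry), a₁.1, a₁.2⟩) ?_ ?_⟩
  · simp [Frag.loop, stepAux_relabel, h, relabelCfg]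
  · exact StepsTo.trans
      (hs.relabel (f := some) (e := some none) (m' := (Frag.loop q F).code) fun _ => rfl) hs'

end Framework

/-! ### Gaps as signed sums over bit strings. -/

section BitSums

/-- The sum of `f` over all bit strings of length `n`. -/
def bitSum : ℕ → (List Bool → ℤ) → ℤ
  | 0, f => f []
  | n + 1, f => bitSum n (fun l => f (true :: l)) + bitSum n (fun l => f (false :: l))

theorem bitSum_congr {n : ℕ} {f g : List Bool → ℤ} (h : ∀ l, l.length = n → f l = g l) :
    bitSum n f = bitSum n g := by
  induction n generalizing f g with
  | zero => exact h [] rfl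
  | succ n ih =>
    simp only [bitSum]
    rw [ih fun l hl => h (true :: l) (by simp [hl]), ih fun l hl => h (false :: l) (by simp [hl])]

theorem bitSum_const_mul (n : ℕ) (c : ℤ) (f : List Bool → ℤ) :
    bitSum n (fun l => c * f l) = c * bitSum n f := by
  induction n generalizing f with
  | zero => rfl
  | succ n ih => simp only [bitSum, ih, mul_add]

theorem bitSum_mul_const (n : ℕ) (c : ℤ) (f : List Bool → ℤ) :
    bitSum n (fun l => f l * c) = bitSum n f * c := by
  simp_rw [mul_comm _ c, bitSum_const_mul]

theorem bitSum_append (a b : ℕ) (f : List Bool → ℤ) :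
    bitSum (a + b) f = bitSum a fun u => bitSum b fun v => f (u ++ v) := by
  induction a generalizing f with
  | zero => simp [bitSum]
  | succ a ih => rw [Nat.add_right_comm]; simp only [bitSum, ih, List.cons_append]

/-- Independent choices multiply: a product of gaps is the gap of a predicate reading disjoint
segments. -/
theorem bitSum_add_eq_mul {a b : ℕ} {f g h : List Bool → ℤ}
    (hf : ∀ u v, u.length = a → v.length = b → f (u ++ v) = g u * h v) :
    bitSum (a + b) f = bitSum a g * bitSum b h := by
  rw [bitSum_append, ← bitSum_mul_const]
  refine bitSum_congr fun u hu => ?_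
  rw [← bitSum_const_mul]
  exact bitSum_congr fun v hv => hf u v hu hv

theorem bitSum_eq_sum_vector (n : ℕ) (f : List Bool → ℤ) :
    bitSum n f = ∑ y : List.Vector Bool n, f y.toList := by
  induction n generalizing f with
  | zero => simp [bitSum, List.Vector.eq_nil]
  | succ n ih =>
    let e : Bool × List.Vector Bool n ≃ List.Vector Bool (n + 1) :=
      { toFun := fun p => p.1 ::ᵥ p.2
        invFun := fun v => (v.head, v.tail)
        left_inv := fun p => by simp
        right_inv := fun v => by simp }
    rw [← e.sum_comp, Fintype.sum_prod_type]
    simp [bitSum, ih, e]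

/-- The value `±1` of a bit. -/
def bitSign (b : Bool) : SignType := if b then 1 else -1

theorem bitSum_bitSign (P : List Bool → Bool) (n : ℕ) :
    bitSum n (fun l => (bitSign (P l) : ℤ)) =
      2 * (Fintype.card {y : List.Vector Bool n // P y.toList = true} : ℤ) - 2 ^ n := by
  have h : ∀ b : Bool, ((bitSign b : SignType) : ℤ) = 2 * (if b = true then 1 else 0) - 1 := by
    decide
  rw [bitSum_eq_sum_vector]
  simp only [h, Finset.sum_sub_distrib, ← Finset.mul_sum, Finset.sum_boole]
  simp [Fintype.card_subtype, card_vector]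

theorem half_lt_acceptFraction_iff (M : List Bool × List Bool → Bool) (x : List Bool) (n : ℕ) :
    1 / 2 < acceptFraction M x n ↔ 0 < bitSum n fun y => (bitSign (M (x, y)) : ℤ) := by
  rw [bitSum_bitSign fun y => M (x, y), acceptFraction, card_vector, Fintype.card_bool,
    lt_div_iff₀ (by positivity), sub_pos, ← Int.cast_lt (R := ℚ)]
  push_cast
  constructor <;> intro h <;> linarith

theorem bitSum_bitSign_le (P : List Bool → Bool) (n : ℕ) :
    bitSum n (fun l => (bitSign (P l) : ℤ)) ≤ 2 ^ n := by
  induction n generalizing P with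
  | zero => simp only [bitSum]; cases P [] <;> decide
  | succ n ih =>
    simp only [bitSum, pow_succ]
    linarith [ih fun l => P (true :: l), ih fun l => P (false :: l)]

/-- A language is in `PP` exactly if it is decided by the sign of the difference between the numbers
of accepting and of rejecting strings. -/
theorem mem_PP_iff (L : Language Bool) : L ∈ PP ↔
    ∃ (p : Polynomial ℕ) (M : List Bool × List Bool → Bool), IsPolyTimePredicate M ∧
      ∀ x, x ∈ L ↔ 0 < bitSum (p.eval x.length) fun y => (bitSign (M (x, y)) : ℤ) := by
  simp only [PP, Set.mem_ofPred_eq, ← half_lt_acceptFraction_iff]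
  refine exists_congr fun p => exists_congr fun M => and_congr_right fun _ => ?_
  constructor
  · exact fun h x => ⟨h.1 x, fun hx => by_contra fun hn => absurd (h.2 x hn) (not_le.2 hx)⟩
  · exact fun h => ⟨fun x => (h x).1, fun x hx => not_lt.1 fun hn => hx ((h x).2 hn)⟩

end BitSums

/-! ### Gaps of the form `z ± 2^k`, and the inequalities for their products. -/

section Blocks

/-- No bit of `l` that is marked in `mask` is set. -/
def maskOk : List Bool → List Bool → Bool
  | m :: ms, b :: bs => !(m && b) && maskOk ms bs
  | _, _ => true

/-- The weight of `s` when the string passes the test of the mask, and `0` otherwise; or else the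
sign of the predicate. The first bit of the string selects one of the two. -/
def blockVal (f : List Bool → Bool) (sel : Bool) (mask : List Bool) : List Bool → SignType
  | [] => 1
  | b :: y => if b then (if maskOk mask y then bitSign !sel else 0) else bitSign (f y)

/-- The mask with `a` unmarked positions among `p`. -/
def levelMask (p a : ℕ) : List Bool := List.replicate a false ++ List.replicate (p - a) true

/-- The product of the values of `a + 1` successive blocks of length `p + 1`, with the numbers
`a, …, 0` of unmarked positions. -/
def levelsVal (p : ℕ) (f : List Bool → Bool) (sel : Bool) : ℕ → List Bool → SignType
  | 0, l => blockVal f sel (levelMask p 0) (l.takeD (p + 1) false)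
  | a + 1, l => blockVal f sel (levelMask p (a + 1)) (l.takeD (p + 1) false) *
      levelsVal p f sel a (l.drop (p + 1))

theorem bitSum_maskOk_replicate_true (b : ℕ) :
    bitSum b (fun l => if maskOk (List.replicate b true) l then 1 else 0) = 1 := by
  induction b with
  | zero => rfl
  | succ b ih =>
    have h0 : bitSum b (fun _ => 0) = 0 := by simpa using bitSum_const_mul b 0 fun _ => 0
    simp [bitSum, List.replicate_succ, maskOk, ih, h0]

theorem bitSum_maskOk (a b : ℕ) :
    bitSum (a + b) (fun l => if maskOk (List.replicate a false ++ List.replicate b true) l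
      then 1 else 0) = 2 ^ a := by
  induction a with
  | zero => simp [bitSum_maskOk_replicate_true]
  | succ a ih =>
    rw [Nat.add_right_comm]
    simp [bitSum, List.replicate_succ, maskOk, ih, pow_succ, mul_two]

/-- Strings starting with `false` contribute the gap of `f`. Among those starting with `true`, only
the `2^a` strings vanishing on the marked positions count, all with the same sign. -/
theorem bitSum_blockVal {p a : ℕ} (ha : a ≤ p) (f : List Bool → Bool) (sel : Bool) :
    bitSum (p + 1) (fun l => (blockVal f sel (levelMask p a) l : ℤ)) =
      bitSum p (fun l => (bitSign (f l) : ℤ)) + (bitSign !sel : ℤ) * 2 ^ a := by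
  have h := bitSum_maskOk a (p - a)
  rw [Nat.add_sub_cancel' ha] at h
  rw [← h, ← bitSum_const_mul]
  simp only [bitSum, blockVal, if_true, levelMask, Bool.false_eq_true, if_false]
  rw [add_comm]
  congr 1
  refine bitSum_congr fun l _ => ?_
  split_ifs with h <;> simp [h]

theorem bitSum_levelsVal {p a : ℕ} (ha : a ≤ p) (f : List Bool → Bool) (sel : Bool) :
    bitSum ((a + 1) * (p + 1)) (fun l => (levelsVal p f sel a l : ℤ)) =
      ∏ k ∈ Finset.range (a + 1),
        (bitSum p (fun l => (bitSign (f l) : ℤ)) + (bitSign !sel : ℤ) * 2 ^ k) := by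
  have htake : ∀ u v : List Bool, u.length = p + 1 → (u ++ v).takeD (p + 1) false = u :=
    fun u v hu => by rw [List.takeD_eq_take _ (by simp [hu]), ← hu, List.take_left]
  induction a with
  | zero =>
    simp only [zero_add, one_mul, Finset.prod_range_one]
    rw [← bitSum_blockVal ha]
    refine bitSum_congr fun l hl => ?_
    have := htake l [] hl
    rw [List.append_nil] at this
    rw [levelsVal, this]
  | succ a ih =>
    rw [Finset.prod_range_succ, ← ih (by omega), ← bitSum_blockVal ha, mul_comm (bitSum _ _),
      add_mul _ 1, one_mul, add_comm]
    refine bitSum_add_eq_mul fun u v hu _ => ?_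
    rw [levelsVal, htake u v hu, ← hu, List.drop_left, SignType.coe_mul]

theorem prod_sq_le_prod_sq {z : ℤ} (hz : z ≤ 0) (n : ℕ) :
    ∏ k ∈ Finset.range n, (z + 2 ^ k) ^ 2 ≤ ∏ k ∈ Finset.range n, (z - 2 ^ k) ^ 2 := by
  refine Finset.prod_le_prod (fun _ _ => sq_nonneg _) fun k _ => ?_
  nlinarith [pow_pos (show (0 : ℤ) < 2 by norm_num) k]

/-- One factor suffices. For `k = Nat.log 2 z`, the bounds `2^k ≤ z < 2^(k+1)` give `3(z - 2^k) ≤ z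
+ 2^k`, hence the 9 after squaring; the assumption `z ≤ 2^p` puts this `k` in the range. Every other
factor only needs `(z - 2^k)² ≤ (z + 2^k)²`. -/
theorem nine_mul_prod_sq_le {z : ℤ} {p : ℕ} (hz : 0 < z) (hp : z ≤ 2 ^ p) :
    9 * ∏ k ∈ Finset.range (p + 1), (z - 2 ^ k) ^ 2 ≤
      ∏ k ∈ Finset.range (p + 1), (z + 2 ^ k) ^ 2 := by
  lift z to ℕ using hz.le
  have hz0 : z ≠ 0 := by rintro rfl; simp at hz
  have hm : Nat.log 2 z ∈ Finset.range (p + 1) := by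
    rw [Finset.mem_range, Nat.lt_succ_iff]
    calc Nat.log 2 z ≤ Nat.log 2 (2 ^ p) := Nat.log_mono_right (by exact_mod_cast hp)
      _ = p := Nat.log_pow (by norm_num) p
  have h1 : (2 : ℤ) ^ Nat.log 2 z ≤ z := by exact_mod_cast Nat.pow_log_le_self 2 hz0
  have h2 : (z : ℤ) < 2 ^ Nat.log 2 z * 2 := by
    have := Nat.lt_pow_succ_log_self (b := 2) (by norm_num) z
    rw [pow_succ] at this
    exact_mod_cast this
  rw [← Finset.mul_prod_erase _ _ hm, ← Finset.mul_prod_erase _ _ hm, ← mul_assoc]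
  refine mul_le_mul (by nlinarith)
    (Finset.prod_le_prod (fun _ _ => sq_nonneg _) fun k _ => ?_)
    (Finset.prod_nonneg fun _ _ => sq_nonneg _) (sq_nonneg _)
  nlinarith [pow_pos (show (0 : ℤ) < 2 by norm_num) k]

/-- Two integers are both positive exactly if a combination of products of shifts of them is. -/
theorem pos_and_pos_iff {z w : ℤ} {p q : ℕ} (hz : z ≤ 2 ^ p) (hw : w ≤ 2 ^ q) {A B C D : ℤ}
    (hA : A = ∏ k ∈ Finset.range (p + 1), (z + 2 ^ k) ^ 2)
    (hB : B = ∏ k ∈ Finset.range (p + 1), (z - 2 ^ k) ^ 2)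
    (hC : C = ∏ k ∈ Finset.range (q + 1), (w + 2 ^ k) ^ 2)
    (hD : D = ∏ k ∈ Finset.range (q + 1), (w - 2 ^ k) ^ 2) :
    0 < A * C - A * D - B * C - B * D ↔ 0 < z ∧ 0 < w := by
  have nn : ∀ (f : ℕ → ℤ) (s : Finset ℕ), 0 ≤ ∏ k ∈ s, f k ^ 2 :=
    fun f s => Finset.prod_nonneg fun _ _ => sq_nonneg _
  have A0 : 0 ≤ A := hA ▸ nn _ _
  have B0 : 0 ≤ B := hB ▸ nn _ _
  have C0 : 0 ≤ C := hC ▸ nn _ _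
  have D0 : 0 ≤ D := hD ▸ nn _ _
  constructor
  · intro h
    refine ⟨?_, ?_⟩ <;> by_contra! hn
    · have : A ≤ B := hA ▸ hB ▸ prod_sq_le_prod_sq hn _
      nlinarith [mul_le_mul_of_nonneg_right this C0, mul_nonneg A0 D0, mul_nonneg B0 D0]
    · have : C ≤ D := hC ▸ hD ▸ prod_sq_le_prod_sq hn _
      nlinarith [mul_le_mul_of_nonneg_left this A0, mul_nonneg B0 C0, mul_nonneg B0 D0]
  · rintro ⟨hz0, hw0⟩
    have h1 : 9 * B ≤ A := hA ▸ hB ▸ nine_mul_prod_sq_le hz0 hz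
    have h2 : 9 * D ≤ C := hC ▸ hD ▸ nine_mul_prod_sq_le hw0 hw
    have A1 : 0 < A := hA ▸ Finset.prod_pos fun k _ => by positivity
    have C1 : 0 < C := hC ▸ Finset.prod_pos fun k _ => by positivity
    -- `AD` and `BC` are at most `AC/9`, and `BD` is at most `AC/81`; together they stay below `AC`.
    nlinarith [mul_pos A1 C1, mul_le_mul_of_nonneg_left h2 A0, mul_le_mul_of_nonneg_right h1 C0,
      mul_le_mul h1 h2 (by positivity) A0]

end Blocks

/-! ### Memory of the program and symbolic execution of its statements. -/

section Program

/-- The work stacks of the program. -/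
inductive Reg
  | inp | arg | xs | xs' | cnt | cnt' | out
  deriving DecidableEq

instance : Fintype Reg :=
  ⟨{.inp, .arg, .xs, .xs', .cnt, .cnt', .out}, fun r => by cases r <;> decide⟩

/-- The alphabets of the work stacks. -/
@[reducible] def RegAlph : Reg → Type
  | .inp => Bool ⊕ Bool
  | .arg => Bool ⊕ Bool
  | .xs => Bool
  | .xs' => Bool
  | .cnt => Bool
  | .cnt' => Bool
  | .out => Bool

/-- The finite control of the program. -/
structure Ctl where
  buf : Option (Bool ⊕ Bool) := none
  coin : Bool := false
  ok : Bool := false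
  res : Bool := false
  sel : Bool := false
  tot : Bool := false
  done : Bool := false
  v : SignType := 1

instance : Finite Ctl :=
  Finite.of_injective
    (fun q : Ctl => (q.buf, q.coin, q.ok, q.res, q.sel, q.tot, q.done, q.v)) fun a b h => by
      cases a; cases b; simpa using h

/-- The part of the memory that the program itself works with. -/
structure Store where
  q : Ctl := {}
  inp : List (Bool ⊕ Bool) := []
  arg : List (Bool ⊕ Bool) := []
  xs : List Bool := []
  xs' : List Bool := []
  cnt : List Bool := []
  cnt' : List Bool := []
  out : List Bool := []

/-- The contents of the work stacks. -/
def Store.get (s : Store) : ∀ r, List (RegAlph r)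
  | .inp => s.inp
  | .arg => s.arg
  | .xs => s.xs
  | .xs' => s.xs'
  | .cnt => s.cnt
  | .cnt' => s.cnt'
  | .out => s.out

variable {K : Type} [DecidableEq K] {Γ : K → Type} {W : Type}

/-- The stack alphabets of the program, next to the stacks `Γ` of its subroutines. -/
@[reducible] def Alph (Γ : K → Type) : K ⊕ Reg → Type
  | .inl k => Γ k
  | .inr r => RegAlph r

/-- The memory with the given store, the subroutines being at rest in the state `w`. -/
def Store.mem (Γ : K → Type) (w : W) (s : Store) : Mem (Alph Γ) (W × Ctl) :=
  ((w, s.q), fun | .inl _ => [] | .inr r => s.get r)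

/-- Statements of the program. -/
abbrev PStmt (Γ : K → Type) (W : Type) := Stmt (Alph Γ) Unit (W × Ctl)

def popS (r : Reg) (f : Ctl → Option (RegAlph r) → Ctl) (q : PStmt Γ W) : PStmt Γ W :=
  .pop (.inr r) (fun s o => (s.1, f s.2 o)) q

def peekS (r : Reg) (f : Ctl → Option (RegAlph r) → Ctl) (q : PStmt Γ W) : PStmt Γ W :=
  .peek (.inr r) (fun s o => (s.1, f s.2 o)) q

def pushS (r : Reg) (f : Ctl → RegAlph r) (q : PStmt Γ W) : PStmt Γ W :=
  .push (.inr r) (fun s => f s.2) q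

def loadS (f : Ctl → Ctl) (q : PStmt Γ W) : PStmt Γ W := .load (fun s => (s.1, f s.2)) q

def ifS (f : Ctl → Bool) (q q' : PStmt Γ W) : PStmt Γ W := .branch (fun s => f s.2) q q'

def again : PStmt Γ W := .goto fun _ => ()

/-- The effect of a statement on a store. -/
def Store.run (w : W) (q : PStmt Γ W) (s : Store) : Cfg (Alph Γ) Unit (W × Ctl) :=
  stepAux q (s.mem Γ w).1 (s.mem Γ w).2

variable {w : W} {q q' : PStmt Γ W} {s : Store}

/-- Translates the update of a dependent function of stacks into the update of a record field, so
that `simp` can execute statements on stores. -/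
theorem Store.mem_update (r : Reg) (c : Ctl) (s' : Store) (l : List (RegAlph r)) (hc : s'.q = c)
    (h : s'.get = Function.update s.get r l) :
    s'.mem Γ w = ((w, c), Function.update (s.mem Γ w).2 (.inr r) l) := by
  subst hc
  refine Prod.ext rfl (funext fun k => ?_)
  let S : ∀ k, List (Alph Γ k) := (s.mem Γ w).2
  change _ = Function.update S (.inr r) l k
  rcases k with k | k
  · rw [Function.update_of_ne (by simp)]; rfl
  · by_cases hk : k = r
    · subst hk
      rw [Function.update_self]
      exact (congrFun h k).trans (Function.update_self ..)
    · rw [Function.update_of_ne (by simpa using hk)]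
      exact (congrFun h k).trans (Function.update_of_ne hk ..)

theorem run_pop {r : Reg} {f : Ctl → Option (RegAlph r) → Ctl} (s' : Store)
    (hc : s'.q = f s.q (s.get r).head?) (h : s'.get = Function.update s.get r (s.get r).tail) :
    s.run w (popS r f q) = s'.run w q := by
  rw [Store.run, Store.run, Store.mem_update r _ s' _ hc h]; rfl

theorem run_push {r : Reg} {f : Ctl → RegAlph r} (s' : Store)
    (hc : s'.q = s.q) (h : s'.get = Function.update s.get r (f s.q :: s.get r)) :
    s.run w (pushS r f q) = s'.run w q := by
  rw [Store.run, Store.run, Store.mem_update r _ s' _ hc h]; rfl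

@[simp] theorem run_load {f} : s.run w (loadS f q) = { s with q := f s.q }.run w q := rfl
@[simp] theorem run_if {f} :
    s.run w (ifS f q q') = cond (f s.q) (s.run w q) (s.run w q') := rfl
@[simp] theorem run_again :
    s.run w (again : PStmt Γ W) = ⟨some (), (s.mem Γ w).1, (s.mem Γ w).2⟩ := rfl
@[simp] theorem run_halt :
    s.run w (.halt : PStmt Γ W) = ⟨none, (s.mem Γ w).1, (s.mem Γ w).2⟩ := rfl

@[simp] theorem run_peek_inp {f : Ctl → Option (Bool ⊕ Bool) → Ctl} :
    s.run w (peekS .inp f q) = { s with q := f s.q s.inp.head? }.run w q := rfl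
@[simp] theorem run_pop_inp {f : Ctl → Option (Bool ⊕ Bool) → Ctl} :
    s.run w (popS .inp f q) = { s with q := f s.q s.inp.head?, inp := s.inp.tail }.run w q :=
  run_pop _ rfl (funext fun r => by cases r <;> rfl)
@[simp] theorem run_pop_xs {f : Ctl → Option Bool → Ctl} :
    s.run w (popS .xs f q) = { s with q := f s.q s.xs.head?, xs := s.xs.tail }.run w q :=
  run_pop _ rfl (funext fun r => by cases r <;> rfl)
@[simp] theorem run_pop_xs' {f : Ctl → Option Bool → Ctl} :
    s.run w (popS .xs' f q) = { s with q := f s.q s.xs'.head?, xs' := s.xs'.tail }.run w q :=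
  run_pop _ rfl (funext fun r => by cases r <;> rfl)
@[simp] theorem run_pop_cnt {f : Ctl → Option Bool → Ctl} :
    s.run w (popS .cnt f q) = { s with q := f s.q s.cnt.head?, cnt := s.cnt.tail }.run w q :=
  run_pop _ rfl (funext fun r => by cases r <;> rfl)
@[simp] theorem run_pop_cnt' {f : Ctl → Option Bool → Ctl} :
    s.run w (popS .cnt' f q) = { s with q := f s.q s.cnt'.head?, cnt' := s.cnt'.tail }.run w q :=
  run_pop _ rfl (funext fun r => by cases r <;> rfl)
@[simp] theorem run_push_arg {f : Ctl → Bool ⊕ Bool} :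
    s.run w (pushS .arg f q) = { s with arg := f s.q :: s.arg }.run w q :=
  run_push _ rfl (funext fun r => by cases r <;> rfl)
@[simp] theorem run_push_xs {f : Ctl → Bool} :
    s.run w (pushS .xs f q) = { s with xs := f s.q :: s.xs }.run w q :=
  run_push _ rfl (funext fun r => by cases r <;> rfl)
@[simp] theorem run_push_xs' {f : Ctl → Bool} :
    s.run w (pushS .xs' f q) = { s with xs' := f s.q :: s.xs' }.run w q :=
  run_push _ rfl (funext fun r => by cases r <;> rfl)
@[simp] theorem run_push_cnt {f : Ctl → Bool} :
    s.run w (pushS .cnt f q) = { s with cnt := f s.q :: s.cnt }.run w q :=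
  run_push _ rfl (funext fun r => by cases r <;> rfl)
@[simp] theorem run_push_cnt' {f : Ctl → Bool} :
    s.run w (pushS .cnt' f q) = { s with cnt' := f s.q :: s.cnt' }.run w q :=
  run_push _ rfl (funext fun r => by cases r <;> rfl)
@[simp] theorem run_push_out {f : Ctl → Bool} :
    s.run w (pushS .out f q) = { s with out := f s.q :: s.out }.run w q :=
  run_push _ rfl (funext fun r => by cases r <;> rfl)

/-- `F.Maps w s s' t`: the program `F` turns the store `s` into `s'` within `t` steps. -/
def Frag.Maps (F : Frag (Alph Γ) (W × Ctl)) (w : W) (s s' : Store) (t : ℕ) : Prop :=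
  F.Exec (s.mem Γ w) (s'.mem Γ w) t

/-- The bit carried by a symbol. -/
def symBit : Option (Bool ⊕ Bool) → Bool
  | some (.inl b) => b
  | some (.inr b) => b
  | none => false

theorem symBit_head?_map_inr (l : List Bool) :
    symBit (l.map (Sum.inr : Bool → Bool ⊕ Bool)).head? = l.head?.getD false := by
  cases l <;> rfl

/-- Move `x` from the input to `xs'`. -/
def splitInput : Frag (Alph Γ) (W × Ctl) :=
  .rep <| peekS .inp (fun c o => { c with buf := o }) <|
    ifS (fun c => (c.buf.elim false Sum.isLeft))
      (popS .inp (fun c _ => c) <| pushS .xs' (fun c => symBit c.buf) again)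
      (loadS (fun c => { c with buf := none }) .halt)

theorem maps_splitInput (x y : List Bool) (s : Store) :
    splitInput.Maps (Γ := Γ) w { s with inp := x.map .inl ++ y.map .inr }
      { s with
        inp := y.map .inr, xs' := x.reverse ++ s.xs', q := { s.q with buf := none } }
      (x.length + 1) := by
  induction x generalizing s with
  | nil =>
    refine Frag.rep_halt ?_
    change Store.run _ _ _ = _
    cases y <;> simp
  | cons b x ih =>
    have := ih { s with xs' := b :: s.xs', q := { s.q with buf := some (.inl b) } }
    simp only [List.reverse_cons, List.append_assoc, List.singleton_append, List.length_cons]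
    refine Frag.rep_again ?_ this
    change Store.run _ _ _ = _
    simp [symBit]

/-- Move `xs'` to `xs`. -/
def restoreXs : Frag (Alph Γ) (W × Ctl) :=
  .rep <| popS .xs' (fun c o => { c with buf := o.map .inl }) <|
    ifS (fun c => c.buf.isSome) (pushS .xs (fun c => symBit c.buf) again) .halt

theorem maps_restoreXs (x : List Bool) (s : Store) :
    restoreXs.Maps (Γ := Γ) w { s with xs' := x }
      { s with xs' := [], xs := x.reverse ++ s.xs, q := { s.q with buf := none } }
      (x.length + 1) := by
  induction x generalizing s with
  | nil =>
    refine Frag.rep_halt ?_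
    change Store.run _ _ _ = _
    simp
  | cons b x ih =>
    have := ih { s with xs := b :: s.xs, q := { s.q with buf := some (.inl b) } }
    simp only [List.reverse_cons, List.append_assoc, List.singleton_append, List.length_cons]
    refine Frag.rep_again ?_ this
    change Store.run _ _ _ = _
    simp [symBit]

end Program

/-! ### Unary arithmetic, copying and masks. -/

section Stages

variable {K : Type} [DecidableEq K] {Γ : K → Type} {W : Type} {w : W}

theorem Frag.Maps.seq {F G : Frag (Alph Γ) (W × Ctl)} {s s₁ s' : Store} {t t' : ℕ}
    (h : F.Maps w s s₁ t) (h' : G.Maps w s₁ s' t') : (F.seq G).Maps w s s' (t + t') :=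
  Frag.Exec.seq h h'

theorem Frag.Maps.mono {F : Frag (Alph Γ) (W × Ctl)} {s s' : Store} {t t' : ℕ}
    (h : F.Maps w s s' t) (ht : t ≤ t') : F.Maps w s s' t' :=
  Frag.Exec.mono h ht

/-- Move `xs` to `xs'`, pushing a symbol to `cnt` for each symbol moved. -/
def countXs : Frag (Alph Γ) (W × Ctl) :=
  .rep <| popS .xs (fun c o => { c with buf := o.map .inl }) <|
    ifS (fun c => c.buf.isSome)
      (pushS .xs' (fun c => symBit c.buf) <| pushS .cnt (fun _ => false) again) .halt

theorem maps_countXs (x : List Bool) (s : Store) :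
    countXs.Maps (Γ := Γ) w { s with xs := x }
      { s with
        xs := [], xs' := x.reverse ++ s.xs', cnt := List.replicate x.length false ++ s.cnt,
        q := { s.q with buf := none } }
      (x.length + 1) := by
  induction x generalizing s with
  | nil =>
    refine Frag.rep_halt ?_
    change Store.run _ _ _ = _
    simp
  | cons b x ih =>
    have := ih { s with
      xs' := b :: s.xs', cnt := false :: s.cnt, q := { s.q with buf := some (.inl b) } }
    simp only [List.reverse_cons, List.append_assoc, List.singleton_append, List.length_cons,
      List.replicate_succ'] at this ⊢
    refine Frag.rep_again ?_ this
    change Store.run _ _ _ = _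
    simp [symBit]

/-- Move `cnt` to `cnt'`. -/
def moveCnt : Frag (Alph Γ) (W × Ctl) :=
  .rep <| popS .cnt (fun c o => { c with buf := o.map .inl }) <|
    ifS (fun c => c.buf.isSome) (pushS .cnt' (fun c => symBit c.buf) again) .halt

theorem maps_moveCnt (x : List Bool) (s : Store) :
    moveCnt.Maps (Γ := Γ) w { s with cnt := x }
      { s with cnt := [], cnt' := x.reverse ++ s.cnt', q := { s.q with buf := none } }
      (x.length + 1) := by
  induction x generalizing s with
  | nil =>
    refine Frag.rep_halt ?_
    change Store.run _ _ _ = _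
    simp
  | cons b x ih =>
    have := ih { s with cnt' := b :: s.cnt', q := { s.q with buf := some (.inl b) } }
    simp only [List.reverse_cons, List.append_assoc, List.singleton_append, List.length_cons]
    refine Frag.rep_again ?_ this
    change Store.run _ _ _ = _
    simp [symBit]

/-- For each symbol of `cnt'`, push `|xs|` symbols to `cnt`. -/
def mulCnt : Frag (Alph Γ) (W × Ctl) :=
  .loop (popS .cnt' (fun c o => { c with buf := o.map .inl }) <|
    ifS (fun c => c.buf.isSome) again .halt) (countXs.seq restoreXs)

/-- A round costs `|x| + 1` steps for each of `countXs` and `restoreXs`, and one for the loop test.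
Restoring appends all of `xs'` to `xs`, so `xs'` has to be empty at the start. -/
theorem maps_mulCnt (m : ℕ) (s : Store) (hs : s.xs' = []) :
    mulCnt.Maps (Γ := Γ) w { s with cnt' := List.replicate m false }
      { s with
        cnt' := [], cnt := List.replicate (m * s.xs.length) false ++ s.cnt,
        q := { s.q with buf := none } }
      (m * (2 * s.xs.length + 3) + 1) := by
  induction m generalizing s with
  | zero =>
    refine (Frag.loop_halt ?_).mono (by simp)
    change Store.run _ _ _ = _
    simp
  | succ m ih =>
    obtain ⟨c, inp, arg, xs, xs', cnt, cnt', out⟩ := s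
    simp only at hs
    subst hs
    have h1 := maps_countXs (Γ := Γ) (w := w) xs
      ⟨{ c with buf := some (.inl false) }, inp, arg, [], [], cnt, List.replicate m false, out⟩
    have h2 := maps_restoreXs (Γ := Γ) (w := w) xs.reverse
      ⟨{ c with buf := none }, inp, arg, [], [], List.replicate xs.length false ++ cnt,
        List.replicate m false, out⟩
    simp only [List.append_nil, List.reverse_reverse] at h1 h2
    have h3 := ih ⟨{ c with buf := none }, inp, arg, xs, [], List.replicate xs.length false ++ cnt,
        [], out⟩ rfl
    simp only [← List.append_assoc, List.replicate_append_replicate] at h3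
    rw [← Nat.succ_mul] at h3
    refine (Frag.loop_again ?_ (h1.seq h2) h3).mono ?_
    · change Store.run _ _ _ = _
      simp [List.replicate_succ]
    · simp; ring_nf; omega

/-- Push `a` symbols to `cnt`. -/
def addCnt (a : ℕ) : Frag (Alph Γ) (W × Ctl) :=
  .rep ((pushS .cnt fun _ => false)^[a] .halt)

theorem maps_addCnt (a : ℕ) (s : Store) : (addCnt a).Maps (Γ := Γ) w s
    { s with cnt := List.replicate a false ++ s.cnt } 1 := by
  refine Frag.rep_halt ?_
  change Store.run _ _ _ = _
  induction a generalizing s with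
  | zero => rfl
  | succ a ih =>
    rw [Function.iterate_succ_apply', run_push_cnt, ih, List.replicate_succ']
    simp

/-- Horner's scheme in unary: adding a constant is `addCnt`, multiplying by the variable is
`moveCnt` followed by `mulCnt`. -/
theorem exists_frag_eval (p : Polynomial ℕ) : ∃ (F : Frag (Alph Γ) (W × Ctl)) (T : Polynomial ℕ),
    ∀ s : Store, s.cnt = [] → s.cnt' = [] → s.xs' = [] → s.q.buf = none →
      F.Maps w s { s with cnt := List.replicate (p.eval s.xs.length) false }
        (T.eval s.xs.length) := by
  classical
  induction p using Polynomial.recOnHorner with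
  | M0 =>
    refine ⟨addCnt 0, 1, fun s hs _ _ _ => ?_⟩
    have := maps_addCnt (Γ := Γ) (w := w) 0 s
    simpa [hs] using this
  | MC p a _ _ ih =>
    obtain ⟨F, T, h⟩ := ih
    refine ⟨F.seq (addCnt a), T + 1, fun s hs hs' hx hb => ?_⟩
    have := (h s hs hs' hx hb).seq (maps_addCnt a _)
    simp only [List.replicate_append_replicate] at this
    simpa [add_comm a] using this
  | MX p _ ih =>
    obtain ⟨F, T, h⟩ := ih
    refine ⟨F.seq (moveCnt.seq mulCnt), T + (p + 1 + (p * (2 * .X + 3) + 1)),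
      fun s hs hs' hx hb => ?_⟩
    have h0 := h s hs hs' hx hb
    obtain ⟨c, inp, arg, xs, xs', cnt, cnt', out⟩ := s
    simp only at hs hs' hx hb
    subst hs hs' hx
    have h1 := maps_moveCnt (Γ := Γ) (w := w) (List.replicate (p.eval xs.length) false)
      ⟨c, inp, arg, xs, [], [], [], out⟩
    have h2 := maps_mulCnt (Γ := Γ) (w := w) (p.eval xs.length)
      ⟨{ c with buf := none }, inp, arg, xs, [], [], [], out⟩ rfl
    simp only [List.reverse_replicate, List.append_nil] at h1 h2
    have := h0.seq (h1.seq h2)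
    rw [← hb] at this
    simpa using this

/-- Copy `xs` to `arg`, moving it to `xs'`. -/
def copyXs : Frag (Alph Γ) (W × Ctl) :=
  .rep <| popS .xs (fun c o => { c with buf := o.map .inl }) <|
    ifS (fun c => c.buf.isSome)
      (pushS .xs' (fun c => symBit c.buf) <| pushS .arg (fun c => .inl (symBit c.buf)) again) .halt

theorem maps_copyXs (x : List Bool) (s : Store) :
    copyXs.Maps (Γ := Γ) w { s with xs := x }
      { s with
        xs := [], xs' := x.reverse ++ s.xs', arg := (x.map .inl).reverse ++ s.arg,
        q := { s.q with buf := none } }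
      (x.length + 1) := by
  induction x generalizing s with
  | nil =>
    refine Frag.rep_halt ?_
    change Store.run _ _ _ = _
    simp
  | cons b x ih =>
    have := ih { s with
      xs' := b :: s.xs', arg := .inl b :: s.arg, q := { s.q with buf := some (.inl b) } }
    simp only [List.reverse_cons, List.append_assoc, List.singleton_append, List.length_cons,
      List.map_cons]
    refine Frag.rep_again ?_ this
    change Store.run _ _ _ = _
    simp [symBit]

/-- Copy as many bits of the input to `arg` as there are symbols in `cnt`, moving these to `cnt'`
and testing the mask. -/
def readBlock : Frag (Alph Γ) (W × Ctl) :=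
  .rep <| popS .cnt (fun c o => { c with buf := o.map .inl }) <|
    ifS (fun c => c.buf.isSome)
      (pushS .cnt' (fun c => symBit c.buf) <|
        popS .inp (fun c o => { c with
          ok := c.ok && !(symBit c.buf && symBit o), buf := some (.inr (symBit o)) }) <|
        pushS .arg (fun c => .inr (symBit c.buf)) again) .halt

/-- An exhausted input is read as `false`, in agreement with the `takeD` of `levelsVal`; the program
is thus correct for every `y`, not only those of the intended length. -/
theorem maps_readBlock (m l : List Bool) (s : Store) :
    readBlock.Maps (Γ := Γ) w { s with cnt := m, inp := l.map .inr }
      { s with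
        cnt := [], cnt' := m.reverse ++ s.cnt', inp := (l.drop m.length).map .inr,
        arg := ((l.takeD m.length false).map .inr).reverse ++ s.arg,
        q := { s.q with buf := none, ok := s.q.ok && maskOk m (l.takeD m.length false) } }
      (m.length + 1) := by
  induction m generalizing s l with
  | nil =>
    refine Frag.rep_halt ?_
    change Store.run _ _ _ = _
    simp [maskOk]
  | cons b m ih =>
    have := ih l.tail { s with
      cnt' := b :: s.cnt', arg := .inr (l.head?.getD false) :: s.arg,
      q := { s.q with buf := some (.inr (l.head?.getD false)),
                      ok := s.q.ok && !(b && l.head?.getD false) } }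
    simp only [List.reverse_cons, List.append_assoc, List.singleton_append, List.length_cons,
      List.map_cons, List.takeD_succ, maskOk, Bool.and_assoc, List.drop_tail] at this ⊢
    refine Frag.rep_again ?_ this
    change Store.run _ _ _ = _
    cases l <;> simp [symBit]

/-- Mark one more position of the mask `l` while reversing it onto `c`. -/
def incrMask : Bool → List Bool → List Bool → Bool × List Bool
  | φ, [], c => (φ, c)
  | φ, m :: l, c => incrMask (φ && m) l ((φ || m) :: c)

theorem incrMask_replicate_true (b : ℕ) (l c : List Bool) :
    incrMask true (List.replicate b true ++ l) c =
      incrMask true l (List.replicate b true ++ c) := by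
  induction b generalizing c with
  | zero => rfl
  | succ b ih =>
    rw [List.replicate_succ, List.cons_append, incrMask]
    simp only [Bool.and_true, Bool.or_true, ih]
    rw [← List.replicate_succ, List.replicate_succ']
    simp

theorem incrMask_replicate_false (a : ℕ) (c : List Bool) :
    incrMask false (List.replicate a false) c = (false, List.replicate a false ++ c) := by
  induction a generalizing c with
  | zero => rfl
  | succ a ih =>
    rw [List.replicate_succ, incrMask]
    simp only [Bool.and_false, Bool.or_false, ih]
    rw [← List.replicate_succ, List.replicate_succ']
    simp

theorem incrMask_levelMask_zero (p : ℕ) :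
    incrMask true (levelMask p 0).reverse [] = (true, levelMask p 0) := by
  have := incrMask_replicate_true p [] []
  simpa [levelMask, incrMask] using this

/-- In the reversed mask the marked positions come first. The flag passes over them, marks the first
unmarked position and is then switched off. It survives only when all positions were already marked,
which signals the last level. -/
theorem incrMask_levelMask_succ {p a : ℕ} (h : a + 1 ≤ p) :
    incrMask true (levelMask p (a + 1)).reverse [] = (false, levelMask p a) := by
  rw [levelMask, List.reverse_append, List.reverse_replicate, List.reverse_replicate,
    incrMask_replicate_true, List.replicate_succ, incrMask]
  simp only [Bool.and_false, Bool.or_false, incrMask_replicate_false, levelMask, List.append_nil]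
  rw [show p - a = p - (a + 1) + 1 by omega, List.replicate_succ]

/-- Move the mask from `cnt'` back to `cnt`, marking one more position. -/
def restoreCnt : Frag (Alph Γ) (W × Ctl) :=
  .rep <| popS .cnt' (fun c o => { c with buf := o.map .inl }) <|
    ifS (fun c => c.buf.isSome)
      (pushS .cnt (fun c => c.done || symBit c.buf) <|
        loadS (fun c => { c with done := c.done && symBit c.buf }) again) .halt

theorem maps_restoreCnt (m : List Bool) (s : Store) :
    restoreCnt.Maps (Γ := Γ) w { s with cnt' := m }
      { s with
        cnt' := [], cnt := (incrMask s.q.done m s.cnt).2,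
        q := { s.q with buf := none, done := (incrMask s.q.done m s.cnt).1 } }
      (m.length + 1) := by
  induction m generalizing s with
  | nil =>
    refine Frag.rep_halt ?_
    change Store.run _ _ _ = _
    simp [incrMask]
  | cons b m ih =>
    have := ih { s with
      cnt := (s.q.done || b) :: s.cnt,
      q := { s.q with buf := some (.inl b), done := s.q.done && b } }
    simp only [List.length_cons, incrMask]
    refine Frag.rep_again ?_ this
    change Store.run _ _ _ = _
    simp [symBit]

end Stages

/-! ### The combined predicate and the program computing it. -/

section Assembly

variable {K : Type} [DecidableEq K] {Γ : K → Type} {W : Type} {w : W}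

theorem Polynomial.eval_mono_nat (T : Polynomial ℕ) {m n : ℕ} (h : m ≤ n) :
    T.eval m ≤ T.eval n := by
  rw [Polynomial.eval_eq_sum_range, Polynomial.eval_eq_sum_range]
  gcongr

/-- `C` computes the predicate `f` on pairs whose reversed encoding is on the stack `arg`. -/
def Computes (C : Frag (Alph Γ) (W × Ctl)) (w : W) (f : List Bool × List Bool → Bool)
    (T : Polynomial ℕ) : Prop :=
  ∀ (x y : List Bool) (s : Store), C.Maps w
    { s with arg := (bitPairEncoding.encode (x, y)).reverse, q := { s.q with buf := none } }
    { s with arg := [], q := { s.q with buf := none, res := f (x, y) } }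
    (T.eval (x.length + y.length))

/-- The stores between the stages of the program. -/
def restStore (sel tot done : Bool) (v : SignType) (x cnt l : List Bool) : Store :=
  { q := { sel := sel, tot := tot, done := done, v := v }
    inp := l.map .inr, xs := x, cnt := cnt }

def startBlock : Frag (Alph Γ) (W × Ctl) :=
  .rep <| popS .inp (fun c o => { c with coin := symBit o, ok := true }) .halt

/-- Setting `done` arms the flag with which `restoreCnt` looks for an unmarked position. -/
def endBlock : Frag (Alph Γ) (W × Ctl) :=
  .rep <| loadS (fun c => { c with
    v := c.v * if c.coin then (if c.ok then bitSign !c.sel else 0) else bitSign c.res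
    coin := false, ok := false, res := false, done := true }) .halt

/-- Evaluate one block of the input and mark one more position. -/
def block (C : Frag (Alph Γ) (W × Ctl)) : Frag (Alph Γ) (W × Ctl) :=
  startBlock.seq <| copyXs.seq <| restoreXs.seq <| readBlock.seq <| C.seq <| endBlock.seq restoreCnt

theorem levelMask_length {p a : ℕ} (h : a ≤ p) : (levelMask p a).length = p := by
  simp [levelMask, h]

theorem incrMask_levelMask {p a : ℕ} (h : a ≤ p) :
    incrMask true (levelMask p a).reverse [] = (decide (a = 0), levelMask p (a - 1)) := by
  cases a with
  | zero => simp [incrMask_levelMask_zero]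
  | succ a => simp [incrMask_levelMask_succ h]

/-- A time bound for the evaluation of one block. -/
def blockTime (T : Polynomial ℕ) (n p : ℕ) : ℕ := T.eval (n + p) + 2 * n + 2 * p + 6

theorem maps_block {C : Frag (Alph Γ) (W × Ctl)} {f : List Bool × List Bool → Bool}
    {T : Polynomial ℕ} (hC : Computes C w f T) {p a : ℕ} (ha : a ≤ p) (sel tot : Bool)
    (v : SignType) (x l : List Bool) :
    (block C).Maps w (restStore sel tot false v x (levelMask p a) l)
      (restStore sel tot (decide (a = 0))
        (v * blockVal (fun y => f (x, y)) sel (levelMask p a) (l.takeD (p + 1) false))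
        x (levelMask p (a - 1)) (l.drop (p + 1)))
      (blockTime T x.length p) := by
  have hlen := levelMask_length ha
  have h1 : startBlock.Maps (Γ := Γ) w (restStore sel tot false v x (levelMask p a) l)
      { restStore sel tot false v x (levelMask p a) l.tail with
        q := { sel := sel, tot := tot, v := v, coin := l.head?.getD false, ok := true } } 1 := by
    refine Frag.rep_halt ?_
    change Store.run _ _ _ = _
    cases l <;> simp [restStore, symBit]
  have h2 := maps_copyXs (Γ := Γ) (w := w) x
    { restStore sel tot false v x (levelMask p a) l.tail with
        q := { sel := sel, tot := tot, v := v, coin := l.head?.getD false, ok := true } }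
  have h3 := maps_restoreXs (Γ := Γ) (w := w) x.reverse
    { restStore sel tot false v [] (levelMask p a) l.tail with
        q := { sel := sel, tot := tot, v := v, coin := l.head?.getD false, ok := true }
        arg := (x.map .inl).reverse }
  have h4 := maps_readBlock (Γ := Γ) (w := w) (levelMask p a) l.tail
    { restStore sel tot false v x [] [] with
        q := { sel := sel, tot := tot, v := v, coin := l.head?.getD false, ok := true }
        arg := (x.map .inl).reverse }
  have h5 := hC x (l.tail.takeD p false)
    { restStore sel tot false v x [] (l.tail.drop p) with
        q := { sel := sel, tot := tot, v := v, coin := l.head?.getD false,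
               ok := maskOk (levelMask p a) (l.tail.takeD p false) }
        cnt' := (levelMask p a).reverse }
  have h6 : endBlock.Maps (Γ := Γ) w
      { restStore sel tot false v x [] (l.tail.drop p) with
        q := { sel := sel, tot := tot, v := v, coin := l.head?.getD false,
               ok := maskOk (levelMask p a) (l.tail.takeD p false)
               res := f (x, l.tail.takeD p false) }
        cnt' := (levelMask p a).reverse }
      { restStore sel tot true
          (v * blockVal (fun y => f (x, y)) sel (levelMask p a) (l.takeD (p + 1) false))
          x [] (l.tail.drop p) with cnt' := (levelMask p a).reverse } 1 := by
    refine Frag.rep_halt ?_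
    change Store.run _ _ _ = _
    simp [restStore, blockVal]
  have h7 := maps_restoreCnt (Γ := Γ) (w := w) (levelMask p a).reverse
    (restStore sel tot true
      (v * blockVal (fun y => f (x, y)) sel (levelMask p a) (l.takeD (p + 1) false))
      x [] (l.tail.drop p))
  simp only [restStore, hlen, List.append_nil, List.reverse_reverse, Bool.true_and,
    incrMask_levelMask ha, List.length_reverse, List.takeD_length, ← List.reverse_append]
    at h1 h2 h3 h4 h5 h6 h7 ⊢
  have := h1.seq (h2.seq (h3.seq (h4.seq (h5.seq (h6.seq h7)))))
  rw [List.drop_tail] at this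
  exact this.mono (by simp only [blockTime]; omega)

def levels (C : Frag (Alph Γ) (W × Ctl)) : Frag (Alph Γ) (W × Ctl) :=
  .loop (ifS (fun c => c.done) .halt again) (block C)

/-- The mask doubles as the loop counter: each block marks one position, and the block at level 0
leaves `done` set. -/
theorem maps_levels {C : Frag (Alph Γ) (W × Ctl)} {f : List Bool × List Bool → Bool}
    {T : Polynomial ℕ} (hC : Computes C w f T) {p a : ℕ} (ha : a ≤ p) (sel tot : Bool)
    (v : SignType) (x l : List Bool) :
    (levels C).Maps w (restStore sel tot false v x (levelMask p a) l)
      (restStore sel tot true (v * levelsVal p (fun y => f (x, y)) sel a l)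
        x (levelMask p 0) (l.drop ((a + 1) * (p + 1))))
      ((a + 1) * (blockTime T x.length p + 1) + 1) := by
  induction a generalizing v l with
  | zero =>
    refine (Frag.loop_again (a₁ := (restStore sel tot false v x (levelMask p 0) l).mem Γ w) rfl
      (maps_block hC ha sel tot v x l) (t' := 1) (Frag.loop_halt ?_)).mono (by omega)
    simp only [decide_true, zero_add, one_mul]
    rfl
  | succ a ih =>
    have := ih (by omega)
      (v * blockVal (fun y => f (x, y)) sel (levelMask p (a + 1)) (l.takeD (p + 1) false))
      (l.drop (p + 1))
    rw [List.drop_drop, mul_assoc v, ← levelsVal,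
      show p + 1 + (a + 1) * (p + 1) = (a + 1 + 1) * (p + 1) by ring] at this
    refine (Frag.loop_again
      (a₁ := (restStore sel tot false v x (levelMask p (a + 1)) l).mem Γ w) rfl
      (maps_block hC ha sel tot v x l) this).mono ?_
    rw [add_mul (a + 1) 1]
    omega

def clearCnt : Frag (Alph Γ) (W × Ctl) :=
  .rep <| popS .cnt (fun c o => { c with buf := o.map .inl }) <|
    ifS (fun c => c.buf.isSome) again (loadS (fun c => { c with done := false }) .halt)

theorem maps_clearCnt (m : List Bool) (s : Store) :
    clearCnt.Maps (Γ := Γ) w { s with cnt := m }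
      { s with cnt := [], q := { s.q with buf := none, done := false } } (m.length + 1) := by
  induction m generalizing s with
  | nil =>
    refine Frag.rep_halt ?_
    change Store.run _ _ _ = _
    simp
  | cons b m ih =>
    refine Frag.rep_again ?_ (ih { s with q := { s.q with buf := some (.inl b) } })
    change Store.run _ _ _ = _
    simp

def clearXs : Frag (Alph Γ) (W × Ctl) :=
  .rep <| popS .xs (fun c o => { c with buf := o.map .inl }) <|
    ifS (fun c => c.buf.isSome) again .halt

theorem maps_clearXs (m : List Bool) (s : Store) :
    clearXs.Maps (Γ := Γ) w { s with xs := m }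
      { s with xs := [], q := { s.q with buf := none } } (m.length + 1) := by
  induction m generalizing s with
  | nil =>
    refine Frag.rep_halt ?_
    change Store.run _ _ _ = _
    simp
  | cons b m ih =>
    refine Frag.rep_again ?_ (ih { s with q := { s.q with buf := some (.inl b) } })
    change Store.run _ _ _ = _
    simp

def clearInp : Frag (Alph Γ) (W × Ctl) :=
  .rep <| popS .inp (fun c o => { c with buf := o }) <| ifS (fun c => c.buf.isSome) again .halt

theorem maps_clearInp (m : List (Bool ⊕ Bool)) (s : Store) :
    clearInp.Maps (Γ := Γ) w { s with inp := m }
      { s with inp := [], q := { s.q with buf := none } } (m.length + 1) := by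
  induction m generalizing s with
  | nil =>
    refine Frag.rep_halt ?_
    change Store.run _ _ _ = _
    simp
  | cons b m ih =>
    refine Frag.rep_again ?_ (ih { s with q := { s.q with buf := some b } })
    change Store.run _ _ _ = _
    simp

theorem exists_stage {C : Frag (Alph Γ) (W × Ctl)} {f : List Bool × List Bool → Bool}
    {T : Polynomial ℕ} (hC : Computes C w f T) (p : Polynomial ℕ) :
    ∃ (F : Frag (Alph Γ) (W × Ctl)) (T' : Polynomial ℕ),
      ∀ (sel tot : Bool) (v : SignType) (x l : List Bool),
        F.Maps w (restStore sel tot false v x [] l)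
          (restStore sel tot false
            (v * levelsVal (p.eval x.length) (fun y => f (x, y)) sel (p.eval x.length) l) x []
            (l.drop ((p.eval x.length + 1) * (p.eval x.length + 1))))
          (T'.eval x.length) := by
  obtain ⟨F, T₀, hF⟩ := exists_frag_eval (Γ := Γ) (w := w) p
  refine ⟨F.seq ((levels C).seq clearCnt),
    T₀ + ((p + 1) * ((T.comp (.X + p) + 2 * .X + 2 * p + 6) + 1) + 1 + (p + 1)),
    fun sel tot v x l => ?_⟩
  have h1 := hF (restStore sel tot false v x [] l) rfl rfl rfl rfl
  have h2 := maps_levels hC (le_refl (p.eval x.length)) sel tot v x l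
  have h3 := maps_clearCnt (Γ := Γ) (w := w) (levelMask (p.eval x.length) 0)
    (restStore sel tot true
      (v * levelsVal (p.eval x.length) (fun y => f (x, y)) sel (p.eval x.length) l) x
      [] (l.drop ((p.eval x.length + 1) * (p.eval x.length + 1))))
  have h0 : levelMask (p.eval x.length) (p.eval x.length) =
      List.replicate (p.eval x.length) false := by simp [levelMask]
  rw [h0] at h2
  rw [levelMask_length (Nat.zero_le _)] at h3
  refine (h1.seq (h2.seq h3)).mono (le_of_eq ?_)
  simp [blockTime, restStore]

/-- The value of the bits that belong to one of the languages: a selector and two stages. -/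
def pieceVal (p : ℕ) (f : List Bool → Bool) (l : List Bool) : SignType :=
  levelsVal p f (l.head?.getD false) p l.tail *
    levelsVal p f (l.head?.getD false) p (l.tail.drop ((p + 1) * (p + 1)))

/-- The number of bits that belong to one of the languages. -/
def pieceLength (p : ℕ) : ℕ := (p + 1) * (p + 1) + (p + 1) * (p + 1) + 1

/-- Two runs of the stage with the same selector, on fresh bits, produce the squares; these make
`A`, `B`, `C`, `D` nonnegative. -/
theorem exists_piece {C : Frag (Alph Γ) (W × Ctl)} {f : List Bool × List Bool → Bool}
    {T : Polynomial ℕ} (hC : Computes C w f T) (p : Polynomial ℕ) :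
    ∃ (F : Frag (Alph Γ) (W × Ctl)) (T' : Polynomial ℕ),
      ∀ (sel tot : Bool) (v : SignType) (x l : List Bool),
        F.Maps w (restStore sel tot false v x [] l)
          (restStore (l.head?.getD false) (tot || l.head?.getD false) false
            (v * pieceVal (p.eval x.length) (fun y => f (x, y)) l) x []
            (l.drop (pieceLength (p.eval x.length))))
          (T'.eval x.length) := by
  obtain ⟨F, T', hF⟩ := exists_stage hC p
  refine ⟨.seq (.rep <| popS .inp
    (fun c o => { c with sel := symBit o, tot := c.tot || symBit o }) .halt) (F.seq F),
    1 + (T' + T'), fun sel tot v x l => ?_⟩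
  have h1 := hF (l.head?.getD false) (tot || l.head?.getD false) v x l.tail
  have h2 := hF (l.head?.getD false) (tot || l.head?.getD false)
    (v * levelsVal (p.eval x.length) (fun y => f (x, y)) (l.head?.getD false)
      (p.eval x.length) l.tail) x
    (l.tail.drop ((p.eval x.length + 1) * (p.eval x.length + 1)))
  have hd : l.tail.drop ((p.eval x.length + 1) * (p.eval x.length + 1) +
      (p.eval x.length + 1) * (p.eval x.length + 1)) = l.drop (pieceLength (p.eval x.length)) := by
    rw [List.drop_tail, pieceLength]
  rw [List.drop_drop, hd, mul_assoc v] at h2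
  refine (Frag.Maps.seq (t := 1) (Frag.rep_halt ?_) (h1.seq h2)).mono (by simp)
  change Store.run _ _ _ = _
  cases l <;> simp [restStore, symBit]

/-- The answer for a value, a sign, and a bit that breaks ties. -/
def finalBit (v : SignType) (tot c : Bool) : Bool :=
  if v = 0 then c else decide (v * bitSign (!tot) = 1)

/-- The predicate computed by the program. -/
def combinedPred (p₁ p₂ : Polynomial ℕ) (f₁ f₂ : List Bool × List Bool → Bool)
    (a : List Bool × List Bool) : Bool :=
  let n₁ := p₁.eval a.1.length
  let n₂ := p₂.eval a.1.length
  let l := a.2.drop (pieceLength n₁)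
  finalBit (pieceVal n₁ (fun y => f₁ (a.1, y)) a.2 * pieceVal n₂ (fun y => f₂ (a.1, y)) l)
    (a.2.head?.getD false || l.head?.getD false)
    ((l.drop (pieceLength n₂)).head?.getD false)

theorem encode_bitPairEncoding (x y : List Bool) :
    bitPairEncoding.encode (x, y) = x.map .inl ++ y.map .inr := rfl

/-- The clearing stages are needed because a machine's output configuration must have empty stacks
apart from the output, and the initial internal state. -/
theorem exists_frag_combinedPred {C₁ C₂ : Frag (Alph Γ) (W × Ctl)}
    {f₁ f₂ : List Bool × List Bool → Bool} {T₁ T₂ : Polynomial ℕ} (h₁ : Computes C₁ w f₁ T₁)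
    (h₂ : Computes C₂ w f₂ T₂) (p₁ p₂ : Polynomial ℕ) :
    ∃ (F : Frag (Alph Γ) (W × Ctl)) (T : Polynomial ℕ), ∀ a : List Bool × List Bool,
      F.Maps w { inp := bitPairEncoding.encode a } { out := [combinedPred p₁ p₂ f₁ f₂ a] }
        (T.eval (bitPairEncoding.encode a).length) := by
  obtain ⟨F₁, T₁, hF₁⟩ := exists_piece h₁ p₁
  obtain ⟨F₂, T₂, hF₂⟩ := exists_piece h₂ p₂
  refine ⟨splitInput.seq <| restoreXs.seq <| F₁.seq <| F₂.seq <| .seq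
    (.rep <| popS .inp (fun c o => { c with res := finalBit c.v c.tot (symBit o) }) .halt) <|
    clearInp.seq <| clearXs.seq <|
    .rep <| pushS .out (fun c => c.res) <| loadS (fun _ => {}) .halt,
    (.X + 1) + ((.X + 1) + (T₁ + (T₂ + (1 + ((.X + 1) + ((.X + 1) + 1)))))), fun ⟨x, y⟩ => ?_⟩
  have g1 := maps_splitInput (Γ := Γ) (w := w) x y {}
  have g2 := maps_restoreXs (Γ := Γ) (w := w) x.reverse { inp := y.map .inr }
  have g3 := hF₁ false false 1 x y
  have g4 := hF₂ (y.head?.getD false) (false || y.head?.getD false)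
    (1 * pieceVal (p₁.eval x.length) (fun y => f₁ (x, y)) y) x
    (y.drop (pieceLength (p₁.eval x.length)))
  set l := y.drop (pieceLength (p₁.eval x.length)) with hl
  set l' := l.drop (pieceLength (p₂.eval x.length)) with hl'
  simp only [Bool.false_or, one_mul] at g3 g4
  set v := pieceVal (p₁.eval x.length) (fun y => f₁ (x, y)) y *
    pieceVal (p₂.eval x.length) (fun y => f₂ (x, y)) l with hv
  set tot := (y.head?.getD false || l.head?.getD false) with htot
  have g5 : Frag.Maps (Γ := Γ)
      (.rep <| popS .inp (fun c o => { c with res := finalBit c.v c.tot (symBit o) }) .halt) w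
      (restStore (l.head?.getD false) tot false v x [] l')
      { restStore (l.head?.getD false) tot false v x [] l'.tail with
        q := { sel := l.head?.getD false, tot := tot, v := v,
               res := finalBit v tot (l'.head?.getD false) } } 1 := by
    refine Frag.rep_halt ?_
    change Store.run _ _ _ = _
    simp only [run_pop_inp, run_halt, restStore, symBit_head?_map_inr, List.map_tail]
  have g6 := maps_clearInp (Γ := Γ) (w := w) (l'.tail.map .inr)
    { restStore (l.head?.getD false) tot false v x [] [] with
        q := { sel := l.head?.getD false, tot := tot, v := v,
               res := finalBit v tot (l'.head?.getD false) } }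
  have g7 := maps_clearXs (Γ := Γ) (w := w) x
    { q := { sel := l.head?.getD false, tot := tot, v := v,
             res := finalBit v tot (l'.head?.getD false) } }
  have g8 : Frag.Maps (Γ := Γ) (.rep <| pushS .out (fun c => c.res) <| loadS (fun _ => {}) .halt) w
      { q := { sel := l.head?.getD false, tot := tot, v := v,
               res := finalBit v tot (l'.head?.getD false) } }
      { out := [finalBit v tot (l'.head?.getD false)] } 1 := by
    refine Frag.rep_halt ?_
    change Store.run _ _ _ = _
    simp
  simp only [List.append_nil, List.reverse_reverse] at g1 g2
  have hlen : l'.tail.length ≤ x.length + y.length := by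
    simp only [hl', hl, List.length_tail, List.length_drop]; omega
  refine (g1.seq <| g2.seq <| g3.seq <| g4.seq <| g5.seq <| g6.seq <| g7.seq g8).mono ?_
  -- The pieces are bounded in terms of `|x|` alone; the total bound is in the length of the whole
  -- input.
  have e1 := T₁.eval_mono_nat (Nat.le_add_right x.length y.length)
  have e2 := T₂.eval_mono_nat (Nat.le_add_right x.length y.length)
  simp only [encode_bitPairEncoding, List.length_append, List.length_map, List.length_reverse,
    Polynomial.eval_add, Polynomial.eval_X, Polynomial.eval_one]
  omega

end Assembly

/-! ### Running given machines inside a larger one. -/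

section Subroutines

/-- The stacks of a family of machines. -/
abbrev FamStack (tm : Bool → FinTM2) := Σ j, (tm j).K

/-- The stack alphabets of a family of machines. -/
@[reducible] def FamAlph (tm : Bool → FinTM2) : FamStack tm → Type
  | ⟨j, k⟩ => (tm j).Γ k

/-- The internal states of a family of machines. -/
abbrev FamState (tm : Bool → FinTM2) := ∀ j, (tm j).σ

variable {tm : Bool → FinTM2}

/-- The memory with stacks `T` of the subroutines and the given store. -/
def Store.memWith (s : Store) (V : FamState tm) (T : ∀ j k, List ((tm j).Γ k)) :
    Mem (Alph (FamAlph tm)) (FamState tm × Ctl) :=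
  ((V, s.q), fun | .inl ⟨j, k⟩ => T j k | .inr r => s.get r)

theorem Store.memWith_nil (s : Store) (V : FamState tm) :
    s.memWith V (fun _ _ => []) = s.mem (FamAlph tm) V :=
  Prod.ext rfl (funext fun k => by rcases k with ⟨j, k⟩ | r <;> rfl)

theorem Store.memWith_update_inl (s : Store) (V : FamState tm) (T : ∀ j k, List ((tm j).Γ k))
    (j : Bool) (k : (tm j).K) (l : List ((tm j).Γ k)) :
    Function.update (s.memWith V T).2 (.inl ⟨j, k⟩) l =
      (s.memWith V (Function.update T j (Function.update (T j) k l))).2 := by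
  funext k'
  rcases k' with ⟨i, k'⟩ | r
  · by_cases hi : i = j
    · subst hi
      by_cases hk : k' = k
      · subst hk; simp [memWith]
      · rw [Function.update_of_ne (by simpa using hk)]
        simp [memWith, hk]
    · rw [Function.update_of_ne (by rintro ⟨⟩; exact hi rfl)]
      simp [memWith, hi]
  · rw [Function.update_of_ne (by simp)]; rfl

theorem Store.memWith_update_arg (s : Store) (V : FamState tm) (T : ∀ j k, List ((tm j).Γ k))
    (l : List (Bool ⊕ Bool)) :
    Function.update (s.memWith V T).2 (.inr .arg) l = ({ s with arg := l }.memWith V T).2 := by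
  funext k'
  rcases k' with ⟨i, k'⟩ | r
  · rw [Function.update_of_ne (by simp)]; rfl
  · cases r
    case arg => rw [Function.update_self]; rfl
    all_goals rw [Function.update_of_ne (by simp)]; rfl

/-- A statement of one of the machines as a statement over the stacks of all of them. -/
def liftStmt (j : Bool) : Stmt (tm j).Γ (tm j).Λ (tm j).σ →
    Stmt (Alph (FamAlph tm)) (tm j).Λ (FamState tm × Ctl)
  | .push k g q => .push (.inl ⟨j, k⟩) (fun s => g (s.1 j)) (liftStmt j q)
  | .peek k g q =>
    .peek (.inl ⟨j, k⟩) (fun s o => (Function.update s.1 j (g (s.1 j) o), s.2)) (liftStmt j q)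
  | .pop k g q =>
    .pop (.inl ⟨j, k⟩) (fun s o => (Function.update s.1 j (g (s.1 j) o), s.2)) (liftStmt j q)
  | .load g q => .load (fun s => (Function.update s.1 j (g (s.1 j)), s.2)) (liftStmt j q)
  | .branch g q₁ q₂ => .branch (fun s => g (s.1 j)) (liftStmt j q₁) (liftStmt j q₂)
  | .goto g => .goto fun s => g (s.1 j)
  | .halt => .halt

/-- A configuration of one of the machines as a configuration over the stacks of all of them. -/
def liftCfg (j : Bool) (V : FamState tm) (T : ∀ j k, List ((tm j).Γ k)) (s : Store)
    (c : Cfg (tm j).Γ (tm j).Λ (tm j).σ) :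
    Cfg (Alph (FamAlph tm)) (tm j).Λ (FamState tm × Ctl) :=
  ⟨c.l, (Function.update V j c.var, s.q), (s.memWith V (Function.update T j c.stk)).2⟩

theorem stepAux_liftStmt (j : Bool) (V : FamState tm) (T : ∀ j k, List ((tm j).Γ k)) (s : Store)
    (q : Stmt (tm j).Γ (tm j).Λ (tm j).σ) : ∀ v S,
      stepAux (liftStmt j q) (Function.update V j v, s.q) (s.memWith V (Function.update T j S)).2 =
        liftCfg j V T s (stepAux q v S) := by
  have hhead : ∀ S k, (s.memWith V (Function.update T j S)).2 (.inl ⟨j, k⟩) = S k := fun S k => by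
    simp [Store.memWith]
  induction q with
  | branch g q₁ q₂ ih₁ ih₂ =>
    intro v S
    simp only [liftStmt, stepAux, Function.update_self]
    cases g v <;> simp [ih₁, ih₂]
  | goto => intro v S; simp [liftStmt, liftCfg]
  | halt => intro v S; rfl
  | load _ _ ih => intro v S; simp [liftStmt, ih]
  | push k g q ih =>
    intro v S
    simp only [liftStmt, stepAux, Function.update_self, Store.memWith_update_inl, hhead,
      Function.update_idem, ih]
  | peek k g q ih =>
    intro v S
    simp only [liftStmt, stepAux, Function.update_self, hhead, Function.update_idem, ih]
  | pop k g q ih =>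
    intro v S
    simp only [liftStmt, stepAux, Function.update_self, Store.memWith_update_inl, hhead,
      Function.update_idem, ih]

theorem StepsTo.liftCfg (j : Bool) (V : FamState tm) (T : ∀ j k, List ((tm j).Γ k)) (s : Store)
    {c c' : Cfg (tm j).Γ (tm j).Λ (tm j).σ} {n : ℕ} (h : StepsTo (tm j).m c c' n) :
    StepsTo (fun l => liftStmt j ((tm j).m l)) (liftCfg j V T s c) (liftCfg j V T s c') n := by
  induction h with
  | refl => exact .refl _
  | @head c _ _ _ hs _ ih =>
    refine .head ?_ ih
    obtain ⟨_ | l, v, S⟩ := c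
    · simp at hs
    · simp only [step, Option.some.injEq] at hs
      subst hs
      exact congrArg some (stepAux_liftStmt j V T s _ v S)

theorem initList_stk (M : FinTM2) (l : List (M.Γ M.k₀)) :
    (initList M l).stk = Function.update (fun _ => []) M.k₀ l := by
  funext k
  by_cases h : k = M.k₀
  · subst h; simp [initList]
  · simp [initList, h]

theorem haltList_stk (M : FinTM2) (l : List (M.Γ M.k₁)) :
    (haltList M l).stk = Function.update (fun _ => []) M.k₁ l := by
  funext k
  by_cases h : k = M.k₁
  · subst h; simp [haltList]
  · simp [haltList, h]

/-- Move the stack `arg` to the input of a machine. -/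
def loadArg (j : Bool) (e : (tm j).Γ (tm j).k₀ ≃ Bool ⊕ Bool) :
    Frag (Alph (FamAlph tm)) (FamState tm × Ctl) :=
  .rep <| popS .arg (fun c o => { c with buf := o }) <|
    ifS (fun c => c.buf.isSome)
      (.push (.inl ⟨j, (tm j).k₀⟩) (fun s => e.symm (s.2.buf.getD (.inl false))) again) .halt

theorem exec_loadArg (j : Bool) (e : (tm j).Γ (tm j).k₀ ≃ Bool ⊕ Bool) (V : FamState tm)
    (a : List (Bool ⊕ Bool)) (L : List ((tm j).Γ (tm j).k₀)) (s : Store) :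
    (loadArg j e).Exec
      ({ s with arg := a }.memWith V
        (Function.update (fun _ _ => []) j (Function.update (fun _ => []) (tm j).k₀ L)))
      ({ s with arg := [], q := { s.q with buf := none } }.memWith V (Function.update (fun _ _ => [])
        j (Function.update (fun _ => []) (tm j).k₀ ((a.map e.symm).reverse ++ L))))
      (a.length + 1) := by
  have hpop : ∀ (s : Store) (T : ∀ j k, List ((tm j).Γ k))
      (q : Stmt (Alph (FamAlph tm)) Unit (FamState tm × Ctl)),
      stepAux (popS .arg (fun c o => { c with buf := o }) q) (s.memWith V T).1 (s.memWith V T).2 =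
        let s' : Store := { s with arg := s.arg.tail, q := { s.q with buf := s.arg.head? } }
        stepAux q (s'.memWith V T).1 (s'.memWith V T).2 := fun s T q => by
    have := s.memWith_update_arg V T s.arg.tail
    rw [popS, stepAux]
    change stepAux q _ (Function.update (s.memWith V T).2 (.inr .arg) s.arg.tail) = _
    rw [this]
    rfl
  induction a generalizing L s with
  | nil =>
    refine Frag.rep_halt ?_
    rw [hpop]
    rfl
  | cons b a ih =>
    have := ih (e.symm b :: L) { s with q := { s.q with buf := some b } }
    simp only [List.map_cons, List.reverse_cons, List.append_assoc, List.singleton_append,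
      List.length_cons]
    refine Frag.rep_again ?_ this
    rw [hpop]
    refine (congrArg (stepAux (again : PStmt (FamAlph tm) (FamState tm)) _)
      (Store.memWith_update_inl ..)).trans ?_
    simp [again, Store.memWith]

/-- Take the bit that a machine has returned. -/
def readOut (j : Bool) (e : (tm j).Γ (tm j).k₁ ≃ Bool) :
    Frag (Alph (FamAlph tm)) (FamState tm × Ctl) :=
  .rep <| .pop (.inl ⟨j, (tm j).k₁⟩)
    (fun s o => (s.1, { s.2 with res := o.elim false e })) .halt

theorem exec_readOut (j : Bool) (e : (tm j).Γ (tm j).k₁ ≃ Bool) (V : FamState tm) (b : Bool)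
    (s : Store) :
    (readOut j e).Exec
      (s.memWith V (Function.update (fun _ _ => []) j
        (Function.update (fun _ => []) (tm j).k₁ [e.symm b])))
      ({ s with q := { s.q with res := b } }.mem (FamAlph tm) V) 1 := by
  refine Frag.rep_halt ?_
  rw [stepAux, Store.memWith_update_inl, ← Store.memWith_nil]
  simp only [Store.memWith, Function.update_self, List.head?_cons, List.tail_cons, stepAux,
    Function.update_idem, Option.elim_some, Equiv.apply_symm_apply]
  rw [Function.update_eq_self (tm j).k₁ (fun _ => []),
    Function.update_eq_self j (fun _ _ => [])]
  rfl

/-- Run a machine on the contents of `arg`, and store the bit that it returns. -/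
def callFrag (j : Bool) (e : (tm j).Γ (tm j).k₀ ≃ Bool ⊕ Bool) (e' : (tm j).Γ (tm j).k₁ ≃ Bool) :
    Frag (Alph (FamAlph tm)) (FamState tm × Ctl) :=
  (loadArg j e).seq <| .seq ⟨(tm j).Λ, (tm j).ΛFin, (tm j).main, fun l => liftStmt j ((tm j).m l)⟩ <|
    readOut j e'

/-- A machine halts in its initial state with only its output stack nonempty. Once the output bit is
popped, the machine is at rest and can be called again. Loading from `arg` undoes the reversal of
the encoding. -/
theorem computes_callFrag (j : Bool) (f : List Bool × List Bool → Bool)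
    (h : TM2ComputableInPolyTime bitPairEncoding.encode Computability.encodeBool f)
    (htm : tm j = h.tm) : ∃ (C : Frag (Alph (FamAlph tm)) (FamState tm × Ctl)) (T : Polynomial ℕ),
      Computes C (fun i => (tm i).initialState) f T := by
  obtain ⟨⟨M, e, e'⟩, T, hout⟩ := h
  subst htm
  refine ⟨callFrag j e e', (.X + 1) + (T + 1), fun x y s => ?_⟩
  set V : FamState tm := fun i => (tm i).initialState with hV
  have hupd : Function.update V j (tm j).initialState = V := Function.update_eq_self j V
  set a := bitPairEncoding.encode (x, y) with ha
  have hlen : a.length = x.length + y.length := by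
    simp [ha, encode_bitPairEncoding]
  obtain ⟨⟨n, hn⟩, hle⟩ := hout (x, y)
  have hs : StepsTo (tm j).m (initList (tm j) (a.map e.symm))
      (haltList (tm j) [e'.symm (f (x, y))]) n := StepsTo.of_iterate_bind hn
  generalize hs₀ : ({ s with arg := [], q := { s.q with buf := none } } : Store) = s₀
  have g1 := exec_loadArg j e V a.reverse [] { s with q := { s.q with buf := none } }
  rw [Function.update_eq_self (tm j).k₀ (fun _ => []),
    Function.update_eq_self j (fun _ _ => []), List.append_nil, ← List.map_reverse,
    List.reverse_reverse, Store.memWith_nil] at g1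
  have g2 : Frag.Exec
      ⟨(tm j).Λ, (tm j).ΛFin, (tm j).main, fun l => liftStmt j ((tm j).m l)⟩
      (s₀.memWith V (Function.update (fun _ _ => []) j
        (Function.update (fun _ => []) (tm j).k₀ (a.map e.symm))))
      (s₀.memWith V (Function.update (fun _ _ => []) j
        (Function.update (fun _ => []) (tm j).k₁ [e'.symm (f (x, y))]))) (T.eval a.length) := by
    refine ⟨n, hle, ?_⟩
    have := hs.liftCfg j V (fun _ _ => []) s₀
    have hc : ∀ c : Cfg (tm j).Γ (tm j).Λ (tm j).σ, c.var = (tm j).initialState →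
        liftCfg j V (fun _ _ => []) s₀ c = ⟨c.l, (V, s₀.q),
          (s₀.memWith V (Function.update (fun _ _ => []) j c.stk)).2⟩ := fun c h => by
      rw [liftCfg, h, hupd]
    rw [hc (initList (tm j) (a.map e.symm)) rfl, hc (haltList (tm j) [e'.symm (f (x, y))]) rfl,
      initList_stk, haltList_stk] at this
    exact this
  have g3 := exec_readOut j e' V (f (x, y)) s₀
  subst hs₀
  refine Frag.Exec.mono (g1.seq (g2.seq g3)) ?_
  simp [hlen]

/-- A program that leaves the value of a predicate on its input as its only output makes the
predicate a polynomial-time predicate. -/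
theorem isPolyTimePredicate_of_maps {K : Type} [DecidableEq K] [Finite K] {Γ : K → Type} {W : Type}
    [Finite W] {w : W} {F : Frag (Alph Γ) (W × Ctl)} {f : List Bool × List Bool → Bool}
    {T : Polynomial ℕ}
    (h : ∀ a : List Bool × List Bool, F.Maps w { inp := bitPairEncoding.encode a } { out := [f a] }
      (T.eval (bitPairEncoding.encode a).length)) : IsPolyTimePredicate f := by
  have := Fintype.ofFinite K
  have := Fintype.ofFinite (W × Ctl)
  have := F.fin
  let M : FinTM2 :=
    { K := K ⊕ Reg, k₀ := .inr .inp, k₁ := .inr .out, Γ := Alph Γ, Λ := F.Λ, main := F.entry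
      σ := W × Ctl, initialState := (w, {}), m := F.code
      Γk₀Fin := inferInstanceAs (Fintype (Bool ⊕ Bool)) }
  have hin : ∀ l : List (Bool ⊕ Bool), (initList M l).stk = (Store.mem Γ w { inp := l }).2 :=
    fun l => by
      rw [initList_stk]
      funext k
      rcases k with k | r
      · exact Function.update_of_ne (by simp [M]) _ _
      · cases r
        case inp => exact Function.update_self _ _ _
        all_goals exact Function.update_of_ne (by simp [M]) _ _
  have hout : ∀ l : List Bool, (haltList M l).stk = (Store.mem Γ w { out := l }).2 :=
    fun l => by
      rw [haltList_stk]
      funext k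
      rcases k with k | r
      · exact Function.update_of_ne (by simp [M]) _ _
      · cases r
        case out => exact Function.update_self _ _ _
        all_goals exact Function.update_of_ne (by simp [M]) _ _
  refine ⟨⟨⟨M, Equiv.refl _, Equiv.refl _⟩, T, fun a => ?_⟩⟩
  have hex : ∃ n ≤ T.eval (bitPairEncoding.encode a).length,
      StepsTo M.m (initList M (bitPairEncoding.encode a)) (haltList M [f a]) n := by
    obtain ⟨n, hn, hs⟩ := h a
    refine ⟨n, hn, ?_⟩
    rw [← hin, ← hout] at hs
    exact hs
  refine ⟨⟨hex.choose, ?_⟩, hex.choose_spec.1⟩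
  have := hex.choose_spec.2.iterate_bind
  change (flip bind (step M.m))^[_] (some (initList M (List.map id _))) =
    some (haltList M (List.map id _))
  rw [List.map_id, List.map_id]
  exact this

end Subroutines

/-! ### The gap of the combined predicate. -/

section Counting

theorem levelsVal_append {p a : ℕ} (f : List Bool → Bool) (sel : Bool) {u : List Bool}
    (hu : (a + 1) * (p + 1) ≤ u.length) (v : List Bool) :
    levelsVal p f sel a (u ++ v) = levelsVal p f sel a u := by
  have htake : p + 1 ≤ u.length → (u ++ v).takeD (p + 1) false = u.takeD (p + 1) false :=
    fun h => by
      rw [List.takeD_eq_take _ h, List.takeD_eq_take _ (by simp; omega),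
        List.take_append_of_le_length h]
  induction a generalizing u with
  | zero => rw [levelsVal, levelsVal, htake (by simpa using hu)]
  | succ a ih =>
    rw [add_mul _ 1, one_mul] at hu
    have hd : (a + 1) * (p + 1) ≤ (u.drop (p + 1)).length := by rw [List.length_drop]; omega
    rw [levelsVal, levelsVal, htake (by omega), List.drop_append_of_le_length (by omega)]
    congr 1
    refine ih hd fun h => ?_
    rw [List.takeD_eq_take _ h, List.takeD_eq_take _ (by simp at h ⊢; omega),
      List.take_append_of_le_length h]

theorem pieceVal_append {p : ℕ} (f : List Bool → Bool) {u : List Bool}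
    (hu : u.length = pieceLength p) (v : List Bool) :
    pieceVal p f (u ++ v) = pieceVal p f u := by
  cases u with
  | nil => simp [pieceLength] at hu
  | cons b u =>
    simp only [pieceLength, List.length_cons, Nat.add_right_cancel_iff] at hu
    simp only [pieceVal, List.cons_append, List.head?_cons, List.tail_cons]
    rw [levelsVal_append f _ (by omega), List.drop_append_of_le_length (by omega),
      levelsVal_append f _ (by rw [List.length_drop]; omega)]

/-- The sum of the values of the bits that belong to one of the languages, for a given selector. -/
def pieceSum (p : ℕ) (f : List Bool → Bool) (sel : Bool) : ℤ :=
  ∏ k ∈ Finset.range (p + 1),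
    (bitSum p (fun l => (bitSign (f l) : ℤ)) + (bitSign !sel : ℤ) * 2 ^ k) ^ 2

/-- The weight `h` leaves room for the final sign, which depends on both selectors jointly and does
not factor over the pieces. -/
theorem bitSum_pieceVal (p : ℕ) (f : List Bool → Bool) (h : Bool → ℤ) :
    bitSum (pieceLength p) (fun l => (pieceVal p f l : ℤ) * h (l.head?.getD false)) =
      pieceSum p f true * h true + pieceSum p f false * h false := by
  have key : ∀ sel, bitSum ((p + 1) * (p + 1) + (p + 1) * (p + 1))
      (fun l => (pieceVal p f (sel :: l) : ℤ)) = pieceSum p f sel := fun sel => by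
    rw [pieceSum, Finset.prod_pow, sq, ← bitSum_levelsVal le_rfl f sel]
    refine bitSum_add_eq_mul fun u v hu _ => ?_
    simp only [pieceVal, List.head?_cons, Option.getD_some, List.tail_cons]
    rw [levelsVal_append f _ hu.ge, ← hu, List.drop_left, SignType.coe_mul]
  simp only [pieceLength, bitSum, List.head?_cons, Option.getD_some, bitSum_mul_const, key]

/-- For `v = 0` the two tie-breaking bits cancel; otherwise both give the same sign, whence the
factor 2. -/
theorem bitSum_finalBit (v : SignType) (tot : Bool) :
    bitSum 1 (fun l => (bitSign (finalBit v tot (l.head?.getD false)) : ℤ)) =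
      2 * ((v : ℤ) * (bitSign !tot : ℤ)) := by
  revert v tot
  decide

/-- The sign is positive only if both selectors are `false`, so `AC` is the one term with a plus. -/
theorem bitSum_combinedPred (p₁ p₂ : Polynomial ℕ) (f₁ f₂ : List Bool × List Bool → Bool)
    (x : List Bool) {A B C D : ℤ}
    (hA : A = pieceSum (p₁.eval x.length) (fun y => f₁ (x, y)) false)
    (hB : B = pieceSum (p₁.eval x.length) (fun y => f₁ (x, y)) true)
    (hC : C = pieceSum (p₂.eval x.length) (fun y => f₂ (x, y)) false)
    (hD : D = pieceSum (p₂.eval x.length) (fun y => f₂ (x, y)) true) :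
    bitSum (pieceLength (p₁.eval x.length) + (pieceLength (p₂.eval x.length) + 1))
        (fun y => (bitSign (combinedPred p₁ p₂ f₁ f₂ (x, y)) : ℤ)) =
      2 * (A * C - A * D - B * C - B * D) := by
  set n₁ := p₁.eval x.length
  set n₂ := p₂.eval x.length
  have hhead : ∀ {n : ℕ} {u : List Bool} (v : List Bool), u.length = pieceLength n →
      (u ++ v).head?.getD false = u.head?.getD false := fun {n u} v hu => by
    cases u with
    | nil => simp [pieceLength] at hu
    | cons => rfl
  have h : ∀ u : List Bool, u.length = pieceLength n₁ → bitSum (pieceLength n₂ + 1)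
      (fun v => (bitSign (combinedPred p₁ p₂ f₁ f₂ (x, u ++ v)) : ℤ)) =
        (pieceVal n₁ (fun y => f₁ (x, y)) u : ℤ) * (fun s : Bool =>
          2 * (D * (bitSign !(s || true) : ℤ) + C * (bitSign !(s || false) : ℤ)))
          (u.head?.getD false) := fun u hu => by
    beta_reduce
    rw [bitSum_append, hC, hD, ← bitSum_pieceVal n₂ (fun y => f₂ (x, y))
      fun s => (bitSign !(u.head?.getD false || s) : ℤ), ← bitSum_const_mul, ← bitSum_const_mul]
    refine bitSum_congr fun v hv => ?_
    have : ∀ c, combinedPred p₁ p₂ f₁ f₂ (x, u ++ (v ++ c)) =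
        finalBit (pieceVal n₁ (fun y => f₁ (x, y)) u * pieceVal n₂ (fun y => f₂ (x, y)) v)
          (u.head?.getD false || v.head?.getD false) (c.head?.getD false) := fun c => by
      simp only [combinedPred]
      rw [pieceVal_append _ hu, List.drop_left' hu, pieceVal_append _ hv, List.drop_left' hv,
        hhead _ hu, hhead _ hv]
    simp only [this]
    rw [bitSum_finalBit, SignType.coe_mul]
    ring
  rw [bitSum_append, bitSum_congr h]
  refine (bitSum_pieceVal n₁ (fun y => f₁ (x, y)) fun s : Bool =>
    2 * (D * (bitSign !(s || true) : ℤ) + C * (bitSign !(s || false) : ℤ))).trans ?_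
  rw [← hA, ← hB]
  simp [bitSign]
  ring

end Counting

/-! ### Closure under binary and finite intersections. -/

theorem inf_mem_PP {L₁ L₂ : Language Bool} (h₁ : L₁ ∈ PP) (h₂ : L₂ ∈ PP) : L₁ ⊓ L₂ ∈ PP := by
  rw [mem_PP_iff] at *
  obtain ⟨p₁, f₁, ⟨M₁⟩, h₁⟩ := h₁
  obtain ⟨p₂, f₂, ⟨M₂⟩, h₂⟩ := h₂
  obtain ⟨C₁, T₁, hC₁⟩ :=
    computes_callFrag (tm := fun j => cond j M₁.tm M₂.tm) true f₁ M₁ rfl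
  obtain ⟨C₂, T₂, hC₂⟩ :=
    computes_callFrag (tm := fun j => cond j M₁.tm M₂.tm) false f₂ M₂ rfl
  obtain ⟨F, T, hF⟩ := exists_frag_combinedPred hC₁ hC₂ p₁ p₂
  have : ∀ j, Finite ((fun j => cond j M₁.tm M₂.tm) j).K :=
    fun _ => @Finite.of_fintype _ (FinTM2.kFin _)
  have : ∀ j, Finite ((fun j => cond j M₁.tm M₂.tm) j).σ :=
    fun _ => @Finite.of_fintype _ (FinTM2.σFin _)
  -- Per language, two stages and a selector bit; then the tie-breaking bit.
  refine ⟨((p₁ + 1) * (p₁ + 1) + (p₁ + 1) * (p₁ + 1) + 1) +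
    (((p₂ + 1) * (p₂ + 1) + (p₂ + 1) * (p₂ + 1) + 1) + 1), combinedPred p₁ p₂ f₁ f₂,
    isPolyTimePredicate_of_maps hF, fun x => ?_⟩
  have hcount := bitSum_combinedPred p₁ p₂ f₁ f₂ x rfl rfl rfl rfl
  have hpos := pos_and_pos_iff
    (bitSum_bitSign_le (fun y => f₁ (x, y)) (p₁.eval x.length))
    (bitSum_bitSign_le (fun y => f₂ (x, y)) (p₂.eval x.length)) rfl rfl rfl rfl
  rw [← h₁, ← h₂] at hpos
  have heval : (((p₁ + 1) * (p₁ + 1) + (p₁ + 1) * (p₁ + 1) + 1) +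
      (((p₂ + 1) * (p₂ + 1) + (p₂ + 1) * (p₂ + 1) + 1) + 1)).eval x.length =
      pieceLength (p₁.eval x.length) + (pieceLength (p₂.eval x.length) + 1) := by
    simp [pieceLength]
  rw [heval, hcount]
  refine (Iff.trans ?_ hpos.symm).trans ?_
  · exact Iff.rfl
  · simp [pieceSum, bitSign, sub_eq_add_neg]

/-- The base case, for the empty family: with `p = 0` the only string is the empty one, and it is
accepted. -/
theorem top_mem_PP : (⊤ : Language Bool) ∈ PP := by
  rw [mem_PP_iff]
  refine ⟨0, fun _ => true, isPolyTimePredicate_of_maps (K := Empty) (Γ := fun _ => Empty)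
    (W := Unit) (w := ())
    (F := clearInp.seq <| .rep <| pushS .out (fun _ => true) <| loadS (fun _ => {}) .halt)
    (T := (.X + 1) + 1) fun a => ?_, fun x => ?_⟩
  · have h := maps_clearInp (Γ := fun _ : Empty => Empty) (w := ()) (bitPairEncoding.encode a) {}
    refine (h.seq (t' := 1) (Frag.rep_halt ?_)).mono (by simp)
    change Store.run _ _ _ = _
    simp
  · simp only [Polynomial.eval_zero, bitSum, bitSign]
    exact iff_of_true trivial (by decide)

theorem mainTheorem8 {ι : Type*} [Finite ι] (L : ι → Language Bool) (hL : ∀ i, L i ∈ PP) :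
    (⨅ i, L i) ∈ PP := by
  have := Fintype.ofFinite ι
  rw [← Finset.inf_univ_eq_iInf]
  exact Finset.inf_induction top_mem_PP (fun _ h₁ _ h₂ => inf_mem_PP h₁ h₂) fun i _ => hL i
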